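/- Throughout $e(x)=e^{2\pi i x}$, $\mathbb H$ is the upper half-plane, and $\gamma=\begin{pmatrix}a&b\\c&d\end{pmatrix}\in SL_2(\mathbb Z)$ acts by $\gamma\tau=\frac{a\tau+b}{c\tau+d}$. **Theta functions.** For a positive integer $m$ and an integer $0\le r<2m$ put, for $\tau\in\mathbb H$, $z\in\mathbb C$, $$\theta^J_{m,r}(\tau,z)=\sum_{n\in\mathbb Z}e\Big(m\big((n+\tfrac r{2m})^2\tau+2(n+\tfrac r{2m})z\big)\Big),\qquad \theta_{m,r}(\tau)=\theta^J_{m,r}(\tau,0).$$ For $\gamma\in SL_2(\mathbb Z)$ let $U_1(\gamma)\in M_2(\mathbb C)$ be the unique matrix with $$\begin{pmatrix}\theta^J_{1,0}\\ \theta^J_{1,1}\end{pmatrix}\Big(\gamma\tau,\frac z{c\tau+d}\Big)=e\Big(\frac{cz^2}{c\tau+d}\Big)(c\tau+d)^{1/2}\,U_1(\gamma)\begin{pmatrix}\theta^J_{1,0}\\ \theta^J_{1,1}\end{pmatrix}(\tau,z)$$ for all $\tau,z$ (principal square root). For $\gamma\in\Gamma_0(m)$ put $\gamma_m=\begin{pmatrix}a&bm\\c/m&d\end{pmatrix}$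 and $\omega_m(\gamma)=\det U_1(\gamma_m)$; this is a character of $\Gamma_0(m)$. **Spaces.** For an integer $k$, a positive integer $M$ and a character $v$ of $\Gamma_0(M)$, $M_k(\Gamma_0(M),v)$ is the space of holomorphic $f:\mathbb H\to\mathbb C$ with $f(\gamma\tau)=v(\gamma)(c\tau+d)^kf(\tau)$ for $\gamma\in\Gamma_0(M)$ such that $(c\tau+d)^{-k}f(g\tau)$ is bounded as $\operatorname{Im}\tau\to\infty$ for every $g=\begin{pmatrix}*&*\\c&d\end{pmatrix}\in SL_2(\mathbb Z)$. For a Dirichlet character $\chi$ modulo $M$, $J_{k,m}(\Gamma_0(M),\chi)$ is the space of holomorphic $\phi:\mathbb H\times\mathbb C\to\mathbb C$ with $$\phi\Big(\gamma\tau,\frac z{c\tau+d}\Big)=\chi(d)(c\tau+d)^ke\Big(\frac{mcz^2}{c\tau+d}\Big)\phi(\tau,z)\quad(\gamma\in\Gamma_0(M)),$$ $$\phi(\tau,z+\lambda\tau+\mu)=e\big(-m(\lambda^2\tau+2\lambda z)\big)\phi(\tau,z)\quad(\lambda,\mu\in\mathbb Z),$$ such that for every $g=\begin{pmatrix}*&*\\c&d\end{pmatrix}\in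 SL_2(\mathbb Z)$ the function $(c\tau+d)^{-k}e\big(-\frac{mcz^2}{c\tau+d}\big)\phi\big(g\tau,\frac z{c\tau+d}\big)$ has an absolutely convergent Fourier expansion $\sum_{n,r} c(n,r)e(n\tau+rz)$ with $r\in\mathbb Z$, $n\in\mathbb Q$ of bounded denominator, and $c(n,r)=0$ unless $n\ge r^2/4m$. Every $\phi\in J_{k,m}(\Gamma_0(M),\chi)$ has a unique theta decomposition $\phi(\tau,z)=\sum_{r=0}^{2m-1}h_{m,r}(\tau)\theta^J_{m,r}(\tau,z)$. Let $J^*_{k,m}(\Gamma_0(M),\chi)$ be the subspace of those $\phi$ with $h_{m,r}=0$ for all $r\ne 0,m$, and let $J^*_{k,m}(\Gamma_0(M),\chi)^0$ be the subspace of those $\phi\in J^*_{k,m}(\Gamma_0(M),\chi)$ for which $D_0\phi:=\phi(\tau,0)$ vanishes identically. **Theorem.** Let $k,m,N$ be positive integers with $m$ square-free, and let $\chi$ be a Dirichlet character modulo $mN$. Then $\theta_{m,0}$ and $\theta_{m,m}$ have no zeros in $\mathbb H$, and there is a $\mathbb C$-linear isomorphism $$\Lambda_m^*: J^*_{k,m}(\Gamma_0(mN),\chi)^0\longrightarrow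 M_{k-1}(\Gamma_0(mN),\chi\,\overline{\omega}_m),\qquad \phi\longmapsto\varphi=\frac{h_{m,0}}{\theta_{m,m}}=\frac{-h_{m,m}}{\theta_{m,0}},$$ where $\chi\,\overline\omega_m$ is the character $\gamma\mapsto\chi(d)\overline{\omega_m(\gamma)}$ of $\Gamma_0(mN)$. Its inverse sends $\varphi$ to $$\phi(\tau,z)=\varphi(\tau)\big(\theta_{m,m}(\tau)\theta^J_{m,0}(\tau,z)-\theta_{m,0}(\tau)\theta^J_{m,m}(\tau,z)\big).$$ -/

import Mathlib

open Complex ModularGroup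
open UpperHalfPlane hiding I
open scoped MatrixGroups Real Manifold ComplexConjugate ModularForm

namespace JacobiTheta

noncomputable section

/-- The Jacobi theta function `θ^J_{m,r}(τ,z) = ∑_{n ∈ ℤ} e(m((n + r/2m)² τ + 2 (n + r/2m) z))`,
where `e(x) = exp(2πix)`. -/
def thetaJ (m r : ℕ) (τ : ℍ) (z : ℂ) : ℂ :=
  ∑' n : ℤ, cexp (2 * π * I * m *
    (((n : ℂ) + r / (2 * m)) ^ 2 * τ + 2 * ((n : ℂ) + r / (2 * m)) * z))

/-- The theta constant `θ_{m,r}(τ) = θ^J_{m,r}(τ,0)`. -/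
def theta (m r : ℕ) (τ : ℍ) : ℂ := thetaJ m r τ 0

/-! ### The index one theta representation -/

/-- `U` describes how the column vector `(θ^J_{1,0}, θ^J_{1,1})` transforms under `γ = (a b; c d)`:
`Θ^J(γ(τ,z)) = e(c z² / (cτ + d)) (cτ + d)^{1/2} U Θ^J(τ,z)`, with the principal square root.
Here `denom γ τ = cτ + d`. -/
def IsThetaMatrix (γ : SL(2, ℤ)) (U : Matrix (Fin 2) (Fin 2) ℂ) : Prop :=
  ∀ (τ : ℍ) (z : ℂ) (i : Fin 2),
    thetaJ 1 i (γ • τ) (z / denom γ τ) =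
      cexp (2 * π * I * ((γ 1 0 : ℤ) * z ^ 2 / denom γ τ)) * denom γ τ ^ (1 / 2 : ℂ) *
        (U.mulVec fun j : Fin 2 => thetaJ 1 j τ z) i

lemma thetaJ_one_eq (r : ℕ) (τ : ℍ) (z : ℂ) :
    thetaJ 1 r τ z = cexp (2 * π * I * (r ^ 2 / 4 * τ + r * z)) *
      jacobiTheta₂ (r * τ + 2 * z) (2 * τ) := by
  unfold thetaJ jacobiTheta₂ jacobiTheta₂_term
  rw [← tsum_mul_left]
  congr 1; ext n
  rw [← Complex.exp_add]
  congr 1; push_cast; ring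

lemma hasSum_thetaJ_one (r : ℕ) (τ : ℍ) (z : ℂ) :
    HasSum (fun n : ℤ => cexp (2 * π * I * (((n : ℂ) + r / 2) ^ 2 * τ + 2 * ((n : ℂ) + r / 2) * z)))
      (thetaJ 1 r τ z) := by
  rw [thetaJ_one_eq]
  have h2 : 0 < (2 * (τ : ℂ)).im := by
    have := τ.im_pos
    simpa using this
  have h := (hasSum_jacobiTheta₂_term (r * τ + 2 * z) h2).mul_left
    (cexp (2 * π * I * (r ^ 2 / 4 * τ + r * z)))
  have e : (fun n : ℤ => cexp (2 * π * I * (((n : ℂ) + r / 2) ^ 2 * τ + 2 * ((n : ℂ) + r / 2) * z)))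
      = fun n : ℤ => cexp (2 * π * I * (r ^ 2 / 4 * τ + r * z)) *
        jacobiTheta₂_term n (r * τ + 2 * z) (2 * τ) := by
    funext n
    unfold jacobiTheta₂_term
    rw [← Complex.exp_add]
    congr 1; ring
  rw [e]
  exact h

lemma thetaJ_split (τ : ℍ) (z : ℂ) :
    jacobiTheta₂ z (τ / 2) = thetaJ 1 0 τ z + thetaJ 1 1 τ z := by
  have h2 : 0 < ((τ : ℂ) / 2).im := by
    have := τ.im_pos
    have h : ((τ : ℂ) / 2).im = τ.im / 2 := by
      rw [show (2 : ℂ) = ((2 : ℝ) : ℂ) by norm_num, Complex.div_ofReal_im]; rfl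
    rw [h]; positivity
  refine (hasSum_jacobiTheta₂_term z h2).unique ?_
  have h0 := hasSum_thetaJ_one 0 τ z
  have h1 := hasSum_thetaJ_one 1 τ z
  have hinj : Function.Injective (fun k : ℤ => 2 * k) := fun a b h => by simpa using h
  have hinj' : Function.Injective (fun k : ℤ => 2 * k + 1) := fun a b h => by simpa using h
  have e0 : HasSum ((fun n : ℤ => jacobiTheta₂_term n z (τ / 2)) ∘ fun k : ℤ => 2 * k)
      (thetaJ 1 0 τ z) := by
    convert h0 using 2 with n
    simp only [Function.comp, jacobiTheta₂_term]
    congr 1; push_cast; ring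
  have e1 : HasSum ((fun n : ℤ => jacobiTheta₂_term n z (τ / 2)) ∘ fun k : ℤ => 2 * k + 1)
      (thetaJ 1 1 τ z) := by
    convert h1 using 2 with n
    simp only [Function.comp, jacobiTheta₂_term]
    congr 1; push_cast; ring
  refine HasSum.add_isCompl ?_ (hinj.hasSum_range_iff.mpr e0) (hinj'.hasSum_range_iff.mpr e1)
  have r0 : (Set.range fun k : ℤ => 2 * k) = {n : ℤ | Even n} := Set.ext fun n =>
    ⟨fun ⟨k, hk⟩ => ⟨k, by simp only at hk; omega⟩, fun ⟨k, hk⟩ => ⟨k, by simp only; omega⟩⟩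
  have r1 : (Set.range fun k : ℤ => 2 * k + 1) = {n : ℤ | Odd n} := Set.ext fun n =>
    ⟨fun ⟨k, hk⟩ => ⟨k, hk.symm⟩, fun ⟨k, hk⟩ => ⟨k, hk.symm⟩⟩
  rw [r0, r1]
  exact Int.isCompl_even_odd

lemma thetaJ_one_sub_half (r : ℕ) (τ : ℍ) (z : ℂ) :
    thetaJ 1 r τ (z - 1 / 2) = (-1) ^ r * thetaJ 1 r τ z := by
  unfold thetaJ
  rw [← tsum_mul_left]
  congr 1; ext n
  have : ((-1 : ℂ)) ^ r = cexp (-(n * (2 * π * I)) - r * (π * I)) := by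
    rw [Complex.exp_sub, Complex.exp_nat_mul (π * I) r, Complex.exp_pi_mul_I]
    rw [show -((n : ℂ) * (2 * π * I)) = ((-n : ℤ) : ℂ) * (2 * π * I) by push_cast; ring,
      Complex.exp_int_mul_two_pi_mul_I, one_div, ← inv_pow]
    norm_num
  rw [this, ← Complex.exp_add]
  congr 1; push_cast; ring

/-- Two square roots of one function on the upper half-plane agree up to a constant sign -/
lemma exists_sign {f g : ℍ → ℂ} (hf : Continuous f) (hg : Continuous g)
    (h : ∀ τ, f τ ^ 2 = g τ ^ 2) (hne : ∀ τ, g τ ≠ 0) :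
    ∃ ε : ℂ, ε ^ 2 = 1 ∧ ∀ τ, f τ = ε * g τ := by
  rcases (isPreconnected_univ (α := ℍ)).eq_or_eq_neg_of_sq_eq hf.continuousOn hg.continuousOn
    (fun τ _ => h τ) (fun {τ} _ => hne τ) with h | h
  · exact ⟨1, by norm_num, fun τ => by simpa using h (Set.mem_univ τ)⟩
  · exact ⟨-1, by norm_num, fun τ => by simpa using h (Set.mem_univ τ)⟩

lemma sqrt_sq (w : ℂ) : (w ^ (1 / 2 : ℂ)) ^ 2 = w := by
  rw [← Complex.cpow_nat_mul]; norm_num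

lemma sqrt_ne_zero {w : ℂ} (hw : w ≠ 0) : w ^ (1 / 2 : ℂ) ≠ 0 := by
  intro h
  have := sqrt_sq w
  rw [h] at this; exact hw (by simpa using this.symm)

lemma continuous_sqrt_denom (γ : SL(2, ℤ)) :
    Continuous fun τ : ℍ => denom γ τ ^ (1 / 2 : ℂ) := by
  simp only [ModularGroup.denom_apply]
  by_cases hc : γ 1 0 = 0
  · simp only [hc]; simpa using continuous_const
  · refine Continuous.cpow (by fun_prop) continuous_const fun τ => ?_
    right
    have : ((γ 1 0 : ℂ) * (τ : ℂ) + (γ 1 1 : ℂ)).im = γ 1 0 * τ.im := by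
      simp
    rw [this]
    exact mul_ne_zero (by exact_mod_cast hc) τ.im_ne_zero

lemma denom_mul (γ γ' : SL(2, ℤ)) (τ : ℍ) :
    denom ((γ * γ' : SL(2, ℤ)) : GL (Fin 2) ℝ) τ = denom γ (γ' • τ : ℍ) * denom γ' τ := by
  have := denom_cocycle_σ (γ : GL (Fin 2) ℝ) (γ' : GL (Fin 2) ℝ) τ
  simpa [σ] using this

lemma cocycle_exp (γ γ' : SL(2, ℤ)) (τ : ℍ) (z : ℂ) :
    ((γ * γ') 1 0 : ℤ) * z ^ 2 / denom ((γ * γ' : SL(2, ℤ)) : GL (Fin 2) ℝ) τ =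
      (γ 1 0 : ℤ) * (z / denom γ' τ) ^ 2 / denom γ (γ' • τ : ℍ) +
        (γ' 1 0 : ℤ) * z ^ 2 / denom γ' τ := by
  have h1 : denom (γ : GL (Fin 2) ℝ) (γ' • τ : ℍ) ≠ 0 := denom_ne_zero _ _
  have h2 : denom (γ' : GL (Fin 2) ℝ) τ ≠ 0 := denom_ne_zero _ _
  have hd : (γ' 0 0 : ℂ) * γ' 1 1 - γ' 0 1 * γ' 1 0 = 1 := by
    have := γ'.det_coe
    rw [Matrix.det_fin_two] at this
    exact_mod_cast this
  have hc : ((γ * γ') 1 0 : ℤ) = γ 1 0 * γ' 0 0 + γ 1 1 * γ' 1 0 := by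
    simp [Matrix.mul_apply, Fin.sum_univ_two]
  have h3 : denom (γ : GL (Fin 2) ℝ) (γ' • τ : ℍ) * denom (γ' : GL (Fin 2) ℝ) τ =
      (γ 1 0 : ℂ) * (γ' 0 0 * τ + γ' 0 1) + γ 1 1 * (γ' 1 0 * τ + γ' 1 1) := by
    rw [ModularGroup.denom_apply] at h2
    rw [ModularGroup.denom_apply, ModularGroup.denom_apply, coe_specialLinearGroup_apply]
    simp only [algebraMap_int_eq, eq_intCast, ofReal_intCast]
    rw [add_mul, mul_assoc, div_mul_cancel₀ _ h2]
  have h4 : denom (γ' : GL (Fin 2) ℝ) τ = (γ' 1 0 : ℂ) * τ + γ' 1 1 := ModularGroup.denom_apply _ _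
  rw [denom_mul, hc]
  push_cast
  field_simp
  linear_combination z ^ 2 * (γ 1 0 : ℂ) * hd - z ^ 2 * (γ' 1 0 : ℂ) * h3 +
    z ^ 2 * ((γ 1 0 : ℂ) * γ' 0 0 + γ 1 1 * γ' 1 0) * h4

lemma IsThetaMatrix.mul {γ γ' : SL(2, ℤ)} {U U' : Matrix (Fin 2) (Fin 2) ℂ}
    (h : IsThetaMatrix γ U) (h' : IsThetaMatrix γ' U') :
    ∃ ε : ℂ, ε ^ 2 = 1 ∧ IsThetaMatrix (γ * γ') (ε • (U * U')) := by
  obtain ⟨ε, hε, hs⟩ := exists_sign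
    (f := fun τ : ℍ => denom γ (γ' • τ : ℍ) ^ (1 / 2 : ℂ) * denom γ' τ ^ (1 / 2 : ℂ))
    (g := fun τ : ℍ => denom ((γ * γ' : SL(2, ℤ)) : GL (Fin 2) ℝ) τ ^ (1 / 2 : ℂ))
    (((continuous_sqrt_denom γ).comp (continuous_const_smul (γ' : GL (Fin 2) ℝ))).mul (continuous_sqrt_denom γ'))
    (continuous_sqrt_denom _)
    (fun τ => by simp only [mul_pow, sqrt_sq, denom_mul])
    (fun τ => sqrt_ne_zero (denom_ne_zero _ _))
  refine ⟨ε, hε, fun τ z i => ?_⟩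
  have hz : z / denom ((γ * γ' : SL(2, ℤ)) : GL (Fin 2) ℝ) τ =
      z / denom γ' τ / denom γ (γ' • τ : ℍ) := by
    rw [denom_mul, div_div, mul_comm]
  have hv : (fun j : Fin 2 => thetaJ 1 j (γ' • τ) (z / denom γ' τ)) =
      (cexp (2 * π * I * ((γ' 1 0 : ℤ) * z ^ 2 / denom γ' τ)) * denom γ' τ ^ (1 / 2 : ℂ)) •
        (U'.mulVec fun j : Fin 2 => thetaJ 1 j τ z) := by
    ext j; rw [h' τ z j]; rfl
  rw [mul_smul, hz, h (γ' • τ) (z / denom γ' τ) i, hv, Matrix.mulVec_smul, Matrix.mulVec_mulVec,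
    Matrix.smul_mulVec, cocycle_exp, mul_add, Complex.exp_add]
  simp only [Pi.smul_apply, smul_eq_mul]
  have := hs τ
  linear_combination (cexp (2 * π * I * ((γ 1 0 : ℤ) * (z / denom γ' τ) ^ 2 / denom γ (γ' • τ : ℍ))) *
    cexp (2 * π * I * ((γ' 1 0 : ℤ) * z ^ 2 / denom γ' τ)) *
    ((U * U').mulVec fun j : Fin 2 => thetaJ 1 j τ z) i) * this

lemma exists_thetaMatrix_T : ∃ U, IsThetaMatrix T U := by
  refine ⟨Matrix.diagonal fun i : Fin 2 => cexp (2 * π * I * (i : ℕ) ^ 2 / 4), fun τ z i => ?_⟩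
  have hd : denom (T : GL (Fin 2) ℝ) τ = 1 := by rw [ModularGroup.denom_apply]; simp [T]
  have h0 : T 1 0 = 0 := by simp [T]
  rw [hd, h0, Matrix.mulVec_diagonal]
  simp only [Int.cast_zero, zero_mul, mul_zero, Complex.exp_zero, Complex.one_cpow,
    one_mul, div_one]
  unfold thetaJ
  rw [← tsum_mul_left]
  congr 1; ext n
  have hn : cexp (2 * π * I * ((n : ℂ) ^ 2 + n * (i : ℕ))) = 1 := by
    rw [mul_comm, show ((n : ℂ) ^ 2 + n * (i : ℕ)) = ((n ^ 2 + n * (i : ℕ) : ℤ) : ℂ) by push_cast; ring,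
      Complex.exp_int_mul_two_pi_mul_I]
  rw [modular_T_smul, coe_vadd, ← one_mul (cexp (_ / 4)), ← hn, ← Complex.exp_add, ← Complex.exp_add]
  congr 1; push_cast; ring

lemma thetaJ_S (τ : ℍ) (z : ℂ) :
    jacobiTheta₂ (2 * z / τ) (-2 / τ) =
      (-I * (τ / 2)) ^ (1 / 2 : ℂ) * cexp (2 * π * I * (z ^ 2 / τ)) *
        (thetaJ 1 0 τ z + thetaJ 1 1 τ z) := by
  have hτ : (τ : ℂ) ≠ 0 := τ.ne_zero
  have hs : (-I * ((τ : ℂ) / 2)) ^ (1 / 2 : ℂ) ≠ 0 := sqrt_ne_zero (by simp [hτ])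
  rw [← thetaJ_split, jacobiTheta₂_functional_equation z (τ / 2)]
  rw [show z / ((τ : ℂ) / 2) = 2 * z / τ by field_simp,
    show -1 / ((τ : ℂ) / 2) = -2 / τ by field_simp,
    show -π * I * z ^ 2 / ((τ : ℂ) / 2) = -(2 * π * I * (z ^ 2 / τ)) by field_simp, Complex.exp_neg]
  have := Complex.exp_ne_zero (2 * π * I * (z ^ 2 / τ))
  field_simp

lemma exists_thetaMatrix_S : ∃ U, IsThetaMatrix S U := by
  obtain ⟨ε, -, hs⟩ := exists_sign
    (f := fun τ : ℍ => (-I * ((τ : ℂ) / 2)) ^ (1 / 2 : ℂ))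
    (g := fun τ : ℍ => (-I / 2) ^ (1 / 2 : ℂ) * denom S τ ^ (1 / 2 : ℂ))
    (by
      refine Continuous.cpow (by fun_prop) continuous_const fun τ => ?_
      left
      have h := τ.im_pos
      simpa using h)
    (continuous_const.mul (continuous_sqrt_denom _))
    (fun τ => by simp only [mul_pow, sqrt_sq, denom_S]; ring)
    (fun τ => mul_ne_zero (sqrt_ne_zero (by simp)) (sqrt_ne_zero (denom_ne_zero _ _)))
  refine ⟨(ε * (-I / 2) ^ (1 / 2 : ℂ)) • !![1, 1; 1, -1], fun τ z i => ?_⟩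
  have hτ : (τ : ℂ) ≠ 0 := τ.ne_zero
  have hs' := hs τ
  simp only [denom_S] at hs'
  have h1 : S 1 0 = 1 := by simp [S]
  have hS : ((S • τ : ℍ) : ℂ) = -1 / τ := by rw [modular_S_smul]; simp [neg_div, inv_neg]
  rw [thetaJ_one_eq, denom_S, h1, hS, Matrix.smul_mulVec]
  fin_cases i
  · have := thetaJ_S τ z
    simp only [Fin.zero_eta, Fin.val_zero, Fin.isValue, Nat.cast_zero, zero_mul, zero_add, ne_eq, OfNat.ofNat_ne_zero, not_false_eq_true, zero_pow, zero_div, mul_zero, Complex.exp_zero, one_mul,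
      Pi.smul_apply, smul_eq_mul, Matrix.mulVec, dotProduct, Fin.sum_univ_two, Int.cast_one]
    rw [show 2 * (z / (τ : ℂ)) = 2 * z / τ by ring, show 2 * (-1 / (τ : ℂ)) = -2 / τ by ring, this,
      hs']
    simp
    ring
  · have := thetaJ_S τ (z - 1 / 2)
    rw [thetaJ_one_sub_half, thetaJ_one_sub_half] at this
    simp only [Fin.mk_one, Fin.val_one, Fin.isValue, Nat.cast_one, one_mul, one_pow,
      Pi.smul_apply, smul_eq_mul, Matrix.mulVec, dotProduct, Fin.sum_univ_two, Int.cast_one]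
    rw [show -1 / (τ : ℂ) + 2 * (z / (τ : ℂ)) = 2 * (z - 1 / 2) / τ by ring,
      show 2 * (-1 / (τ : ℂ)) = -2 / τ by ring, this, hs',
      show 2 * π * I * (z ^ 2 / τ) = 2 * π * I * (1 / 4 * (-1 / τ) + z / τ) +
        2 * π * I * ((z - 1 / 2) ^ 2 / τ) by ring, Complex.exp_add]
    simp
    ring

lemma exists_thetaMatrix (γ : SL(2, ℤ)) : ∃ U, IsThetaMatrix γ U := by
  have hmul : ∀ {γ γ' : SL(2, ℤ)}, (∃ U, IsThetaMatrix γ U) → (∃ U, IsThetaMatrix γ' U) →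
      ∃ U, IsThetaMatrix (γ * γ') U := by
    rintro γ γ' ⟨U, h⟩ ⟨U', h'⟩
    obtain ⟨ε, -, h⟩ := h.mul h'
    exact ⟨_, h⟩
  have hγ : γ ∈ Subgroup.closure {S, T} := by simp [SpecialLinearGroup.SL2Z_generators]
  have hS := exists_thetaMatrix_S
  have hT := exists_thetaMatrix_T
  have hST := hmul hS hT
  have hSi : S⁻¹ = S * (S * S) := by decide
  have hTi : T⁻¹ = S * (S * ((S * T) * ((S * T) * S))) := by decide
  induction hγ using Subgroup.closure_induction_left with
  | one =>
    rw [show (1 : SL(2, ℤ)) = S * S⁻¹ by simp, hSi]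
    exact hmul hS (hmul hS (hmul hS hS))
  | mul_left x hx y hy ih =>
    obtain rfl | rfl : x = S ∨ x = T := hx
    · exact hmul hS ih
    · exact hmul hT ih
  | inv_mul_cancel x hx y hy ih =>
    obtain rfl | rfl : x = S ∨ x = T := hx
    · rw [hSi]; exact hmul (hmul hS (hmul hS hS)) ih
    · rw [hTi]; exact hmul (hmul hS (hmul hS (hmul hST (hmul hST hS)))) ih


lemma thetaJ_one_ne_zero (r : ℕ) : thetaJ 1 r UpperHalfPlane.I 0 ≠ 0 := by
  have h := hasSum_thetaJ_one r UpperHalfPlane.I 0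
  have e : (fun n : ℤ => cexp (2 * π * I * (((n : ℂ) + r / 2) ^ 2 * (UpperHalfPlane.I : ℍ) +
      2 * ((n : ℂ) + r / 2) * 0))) =
      fun n : ℤ => ((Real.exp (-(2 * π * ((n : ℝ) + r / 2) ^ 2)) : ℝ) : ℂ) := by
    ext n
    rw [Complex.ofReal_exp, UpperHalfPlane.coe_I]
    congr 1
    push_cast
    linear_combination (2 * π * ((n : ℂ) + r / 2) ^ 2) * Complex.I_mul_I
  rw [e] at h
  have hs : Summable fun n : ℤ => Real.exp (-(2 * π * ((n : ℝ) + r / 2) ^ 2)) :=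
    Complex.summable_ofReal.mp h.summable
  rw [← h.tsum_eq, ← Complex.ofReal_tsum]
  exact Complex.ofReal_ne_zero.mpr
    (hs.tsum_pos (fun _ => (Real.exp_pos _).le) 0 (Real.exp_pos _)).ne'

lemma IsThetaMatrix.unique {γ : SL(2, ℤ)} {U U' : Matrix (Fin 2) (Fin 2) ℂ}
    (h : IsThetaMatrix γ U) (h' : IsThetaMatrix γ U') : U = U' := by
  have key : ∀ z i, (U.mulVec fun j : Fin 2 => thetaJ 1 j UpperHalfPlane.I z) i =
      (U'.mulVec fun j : Fin 2 => thetaJ 1 j UpperHalfPlane.I z) i := fun z i =>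
    mul_left_cancel₀ (mul_ne_zero (Complex.exp_ne_zero _) (sqrt_ne_zero (denom_ne_zero _ _)))
      ((h _ z i).symm.trans (h' _ z i))
  have n0 := thetaJ_one_ne_zero 0
  have n1 := thetaJ_one_ne_zero 1
  have key' : ∀ i, U i 0 = U' i 0 ∧ U i 1 = U' i 1 := by
    intro i
    have k0 := key 0 i
    have k1 := key (0 - 1 / 2) i
    simp only [Matrix.mulVec, dotProduct, Fin.sum_univ_two, thetaJ_one_sub_half, Fin.val_zero,
      Fin.val_one, pow_zero, pow_one] at k0 k1
    constructor
    · apply mul_right_cancel₀ n0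
      linear_combination (k0 + k1) / 2
    · apply mul_right_cancel₀ n1
      linear_combination (k0 - k1) / 2
  ext i j
  fin_cases j
  · exact (key' i).1
  · exact (key' i).2

lemma isThetaMatrix_one : IsThetaMatrix 1 1 := by
  intro τ z i
  have hd : denom ((1 : SL(2, ℤ)) : GL (Fin 2) ℝ) τ = 1 := by
    rw [ModularGroup.denom_apply]; simp
  rw [hd]
  simp

/-- The matrix `U_1(γ)` of the (projective) theta representation of index one: the unique matrix
through which `γ` acts on `(θ^J_{1,0}, θ^J_{1,1})`. -/
def weilMatrix (γ : SL(2, ℤ)) : Matrix (Fin 2) (Fin 2) ℂ :=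
  Classical.choose (exists_thetaMatrix γ)

lemma weilMatrix_spec (γ : SL(2, ℤ)) : IsThetaMatrix γ (weilMatrix γ) :=
  Classical.choose_spec (exists_thetaMatrix γ)

lemma det_weilMatrix_one : (weilMatrix 1).det = 1 := by
  rw [(weilMatrix_spec 1).unique isThetaMatrix_one, Matrix.det_one]

lemma det_weilMatrix_mul (γ γ' : SL(2, ℤ)) :
    (weilMatrix (γ * γ')).det = (weilMatrix γ).det * (weilMatrix γ').det := by
  obtain ⟨ε, hε, h⟩ := (weilMatrix_spec γ).mul (weilMatrix_spec γ')
  rw [(weilMatrix_spec (γ * γ')).unique h, Matrix.det_smul, Matrix.det_mul, Fintype.card_fin, hε,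
    one_mul]

lemma dvd_of_mem_Gamma0 {m : ℕ} (γ : CongruenceSubgroup.Gamma0 m) :
    (m : ℤ) ∣ (γ : SL(2, ℤ)) 1 0 :=
  (ZMod.intCast_zmod_eq_zero_iff_dvd _ m).mp (CongruenceSubgroup.Gamma0_mem.mp γ.2)

/-- For `γ = (a b; c d) ∈ Γ₀(m)`, the matrix `γ_m = (a bm; c/m d) ∈ SL₂(ℤ)`. -/
def conjByIndex (m : ℕ) (γ : CongruenceSubgroup.Gamma0 m) : SL(2, ℤ) :=
  ⟨!![(γ : SL(2, ℤ)) 0 0, (γ : SL(2, ℤ)) 0 1 * m; (γ : SL(2, ℤ)) 1 0 / m, (γ : SL(2, ℤ)) 1 1], by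
    have hd := (γ : SL(2, ℤ)).det_coe
    rw [Matrix.det_fin_two] at hd
    rw [Matrix.det_fin_two_of, mul_assoc, Int.mul_ediv_cancel' (dvd_of_mem_Gamma0 γ)]
    exact hd⟩

lemma conjByIndex_one (m : ℕ) : conjByIndex m 1 = 1 := by
  ext i j
  fin_cases i <;> fin_cases j <;> simp [conjByIndex]

lemma conjByIndex_mul (m : ℕ) (γ γ' : CongruenceSubgroup.Gamma0 m) :
    conjByIndex m (γ * γ') = conjByIndex m γ * conjByIndex m γ' := by
  obtain ⟨e, he⟩ := dvd_of_mem_Gamma0 γ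
  obtain ⟨e', he'⟩ := dvd_of_mem_Gamma0 γ'
  have hmul : ∀ i j, ((γ * γ' : CongruenceSubgroup.Gamma0 m) : SL(2, ℤ)) i j =
      (γ : SL(2, ℤ)) i 0 * (γ' : SL(2, ℤ)) 0 j + (γ : SL(2, ℤ)) i 1 * (γ' : SL(2, ℤ)) 1 j :=
    fun i j => by
      rw [Subgroup.coe_mul, Matrix.SpecialLinearGroup.coe_mul, Matrix.mul_apply, Fin.sum_univ_two]
  apply Subtype.ext
  rw [Matrix.SpecialLinearGroup.coe_mul]
  simp only [conjByIndex, hmul, he, he']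
  rw [Matrix.mul_fin_two]
  rw [show (m : ℤ) * e * (γ' : SL(2, ℤ)) 0 0 + (γ : SL(2, ℤ)) 1 1 * (m * e') =
    m * (e * (γ' : SL(2, ℤ)) 0 0 + (γ : SL(2, ℤ)) 1 1 * e') by ring]
  rcases eq_or_ne (m : ℤ) 0 with hm | hm
  · simp [hm]
  · simp only [Int.mul_ediv_cancel_left _ hm]
    ring_nf

/-- The character `ω_m(γ) = det U_1(γ_m)` of `Γ₀(m)`. -/
def omega (m : ℕ) : CongruenceSubgroup.Gamma0 m →* ℂ where
  toFun γ := (weilMatrix (conjByIndex m γ)).det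
  map_one' := by rw [conjByIndex_one, det_weilMatrix_one]
  map_mul' γ γ' := by rw [conjByIndex_mul, det_weilMatrix_mul]

lemma Gamma0_mul_le (m N : ℕ) :
    CongruenceSubgroup.Gamma0 (m * N) ≤ CongruenceSubgroup.Gamma0 m := fun γ hγ =>
  CongruenceSubgroup.Gamma0_mem.mpr <| (ZMod.intCast_zmod_eq_zero_iff_dvd _ m).mpr <|
    (Int.natCast_dvd_natCast.mpr (dvd_mul_right m N)).trans (dvd_of_mem_Gamma0 ⟨γ, hγ⟩)

/-- The character `χ · ω̄_m` of `Γ₀(mN)`, for a Dirichlet character `χ` modulo `mN`: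
`γ = (a b; c d) ↦ χ(d) · conj (ω_m(γ))`. -/
def chiOmegaBar (m N : ℕ) (χ : DirichletCharacter ℂ (m * N))
    (γ : CongruenceSubgroup.Gamma0 (m * N)) : ℂ :=
  χ (((γ : SL(2, ℤ)) 1 1 : ℤ) : ZMod (m * N)) *
    conj (omega m (Subgroup.inclusion (Gamma0_mul_le m N) γ))

/-! ### Modular forms with a character -/

/-- The space `M_k(Γ₀(M), v)` of modular forms of weight `k` for `Γ₀(M)` with character `v`:
holomorphic functions `f` on the upper half-plane with `f(γτ) = v(γ) (cτ + d)^k f(τ)` for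
`γ ∈ Γ₀(M)`, holomorphic at all cusps, that is, `f ∣[k] g` is bounded at `i∞` for all
`g ∈ SL₂(ℤ)`. -/
def modularForms (k : ℤ) (M : ℕ) (v : CongruenceSubgroup.Gamma0 M → ℂ) : Submodule ℂ (ℍ → ℂ) where
  carrier := {f | MDifferentiable 𝓘(ℂ) 𝓘(ℂ) f ∧
    (∀ γ : CongruenceSubgroup.Gamma0 M, f ∣[k] (γ : SL(2, ℤ)) = v γ • f) ∧
    ∀ g : SL(2, ℤ), IsBoundedAtImInfty (f ∣[k] g)}
  zero_mem' := ⟨mdifferentiable_const, fun γ => by simp, fun g => by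
    rw [SlashAction.zero_slash]
    exact Filter.const_boundedAtFilter _ 0⟩
  add_mem' := by
    rintro f f' ⟨h1, h2, h3⟩ ⟨h1', h2', h3'⟩
    refine ⟨h1.add h1', fun γ => ?_, fun g => ?_⟩
    · rw [SlashAction.add_slash, h2, h2', smul_add]
    · rw [SlashAction.add_slash]
      exact (h3 g).add (h3' g)
  smul_mem' := by
    rintro c f ⟨h1, h2, h3⟩
    refine ⟨h1.const_smul c, fun γ => ?_, fun g => ?_⟩
    · rw [ModularForm.SL_smul_slash, h2, smul_comm]
    · rw [ModularForm.SL_smul_slash]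
      exact (h3 g).smul c

/-! ### Jacobi forms -/

/-- The weight `k`, index `m` action of `γ = (a b; c d) ∈ SL₂(ℤ)` on functions on `ℍ × ℂ`:
`(φ|γ)(τ,z) = (cτ + d)^{-k} e(-m c z² / (cτ + d)) φ(γτ, z / (cτ + d))`. -/
def jacobiSlash (k : ℤ) (m : ℕ) (φ : ℍ → ℂ → ℂ) (γ : SL(2, ℤ)) : ℍ → ℂ → ℂ := fun τ z =>
  denom γ τ ^ (-k) * cexp (-(2 * π * I * (m * ((γ 1 0 : ℤ) * z ^ 2 / denom γ τ)))) *
    φ (γ • τ) (z / denom γ τ)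

/-- `φ` is holomorphic on `ℍ × ℂ`, jointly in both variables. -/
def IsHolomorphic (φ : ℍ → ℂ → ℂ) : Prop :=
  DifferentiableOn ℂ (fun p : ℂ × ℂ => φ (ofComplex p.1) p.2) {p | 0 < p.1.im}

/-- `φ` has an absolutely convergent Fourier expansion `∑ c(n,r) e(nτ + rz)`, with `r ∈ ℤ` and with
`n` rational of bounded denominator, in which `c(n,r) = 0` unless `n ≥ r² / 4m`. -/
def HasJacobiExpansion (m : ℕ) (φ : ℍ → ℂ → ℂ) : Prop :=
  ∃ c : ℚ → ℤ → ℂ,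
    (∃ M : ℕ, 0 < M ∧ ∀ n r, c n r ≠ 0 → ∃ j : ℤ, n = j / M) ∧
    (∀ n r, c n r ≠ 0 → (r : ℚ) ^ 2 / (4 * m) ≤ n) ∧
    ∀ (τ : ℍ) (z : ℂ), HasSum
      (fun p : ℚ × ℤ => c p.1 p.2 * cexp (2 * π * I * (p.1 * τ + p.2 * z))) (φ τ z)

lemma HasJacobiExpansion.zero (m : ℕ) : HasJacobiExpansion m 0 :=
  ⟨0, ⟨1, one_pos, fun _ _ h => absurd rfl h⟩, fun _ _ h => absurd rfl h,
    fun _ _ => by simp⟩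

lemma HasJacobiExpansion.add {m : ℕ} {φ ψ : ℍ → ℂ → ℂ} (h : HasJacobiExpansion m φ)
    (h' : HasJacobiExpansion m ψ) : HasJacobiExpansion m (φ + ψ) := by
  obtain ⟨c, ⟨M, hM, hd⟩, hc, hs⟩ := h
  obtain ⟨c', ⟨M', hM', hd'⟩, hc', hs'⟩ := h'
  have hor : ∀ n r, (c + c') n r ≠ 0 → c n r ≠ 0 ∨ c' n r ≠ 0 := by
    intro n r hne
    by_contra! hcon
    exact hne (by simp [hcon.1, hcon.2])
  have hMq : (M : ℚ) ≠ 0 := by positivity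
  have hMq' : (M' : ℚ) ≠ 0 := by positivity
  refine ⟨c + c', ⟨M * M', by positivity, fun n r hne => ?_⟩, fun n r hne => ?_, fun τ z => ?_⟩
  · rcases hor n r hne with h0 | h0
    · obtain ⟨j, rfl⟩ := hd n r h0
      exact ⟨j * M', by push_cast; field_simp⟩
    · obtain ⟨j, rfl⟩ := hd' n r h0
      exact ⟨j * M, by push_cast; field_simp⟩
  · rcases hor n r hne with h0 | h0
    · exact hc n r h0
    · exact hc' n r h0
  · simpa [add_mul] using (hs τ z).add (hs' τ z)

lemma HasJacobiExpansion.smul {m : ℕ} {φ : ℍ → ℂ → ℂ} (a : ℂ) (h : HasJacobiExpansion m φ) :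
    HasJacobiExpansion m (a • φ) := by
  obtain ⟨c, ⟨M, hM, hd⟩, hc, hs⟩ := h
  have hor : ∀ n r, (a • c) n r ≠ 0 → c n r ≠ 0 := fun n r hne h0 => hne (by simp [h0])
  exact ⟨a • c, ⟨M, hM, fun n r hne => hd n r (hor n r hne)⟩, fun n r hne => hc n r (hor n r hne),
    fun τ z => by simpa [mul_assoc] using (hs τ z).mul_left a⟩

/-- The space `J_{k,m}(Γ₀(M), χ)` of Jacobi forms of weight `k`, index `m` and character `χ` for the
Jacobi group `Γ₀(M) ⋉ ℤ²`: holomorphic functions on `ℍ × ℂ` with the modular and the elliptic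
transformation laws and with the usual Fourier expansion condition at every cusp. -/
def jacobiForms (k : ℤ) (m M : ℕ) (χ : DirichletCharacter ℂ M) : Submodule ℂ (ℍ → ℂ → ℂ) where
  carrier := {φ | IsHolomorphic φ ∧
    (∀ γ ∈ CongruenceSubgroup.Gamma0 M, jacobiSlash k m φ γ = χ ((γ 1 1 : ℤ) : ZMod M) • φ) ∧
    (∀ (l μ : ℤ) (τ : ℍ) (z : ℂ), φ τ (z + l * τ + μ) =
      cexp (-(2 * π * I * (m * (l ^ 2 * τ + 2 * l * z)))) * φ τ z) ∧
    ∀ g : SL(2, ℤ), HasJacobiExpansion m (jacobiSlash k m φ g)}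
  zero_mem' := by
    have h0 : ∀ g, jacobiSlash k m 0 g = 0 := fun g => by ext τ z; simp [jacobiSlash]
    refine ⟨differentiableOn_const 0, fun γ _ => by simp [h0], fun _ _ _ _ => by simp, fun g => ?_⟩
    rw [h0]
    exact HasJacobiExpansion.zero m
  add_mem' := by
    rintro φ ψ ⟨h1, h2, h3, h4⟩ ⟨h1', h2', h3', h4'⟩
    have ha : ∀ g, jacobiSlash k m (φ + ψ) g = jacobiSlash k m φ g + jacobiSlash k m ψ g :=
      fun g => by ext τ z; simp [jacobiSlash, mul_add]
    refine ⟨h1.add h1', fun γ hγ => ?_, fun l μ τ z => ?_, fun g => ?_⟩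
    · rw [ha, h2 γ hγ, h2' γ hγ, smul_add]
    · simp only [Pi.add_apply, h3, h3', mul_add]
    · rw [ha]
      exact (h4 g).add (h4' g)
  smul_mem' := by
    rintro a φ ⟨h1, h2, h3, h4⟩
    have ha : ∀ g, jacobiSlash k m (a • φ) g = a • jacobiSlash k m φ g :=
      fun g => by ext τ z; simp only [jacobiSlash, Pi.smul_apply, smul_eq_mul]; ring
    refine ⟨h1.const_smul a, fun γ hγ => ?_, fun l μ τ z => ?_, fun g => ?_⟩
    · rw [ha, h2 γ hγ, smul_comm]
    · simp only [Pi.smul_apply, h3, smul_eq_mul]; ring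
    · rw [ha]
      exact (h4 g).smul a

/-- `h` is the family of theta components of `φ`:
`φ(τ,z) = ∑_{0 ≤ r < 2m} h_{m,r}(τ) θ^J_{m,r}(τ,z)`. The family is indexed by the residues
`0, …, 2m - 1` and extended by zero. -/
def IsThetaDecomposition (m : ℕ) (φ : ℍ → ℂ → ℂ) (h : ℕ → ℍ → ℂ) : Prop :=
  (∀ r, 2 * m ≤ r → h r = 0) ∧
    ∀ (τ : ℍ) (z : ℂ), φ τ z = ∑ r ∈ Finset.range (2 * m), h r τ * thetaJ m r τ z

/-- The space `J*_{k,m}(Γ₀(M), χ)` of the Jacobi forms whose theta components `h_{m,r}` vanish for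
`r ≠ 0, m`. -/
def jacobiFormsStar (k : ℤ) (m M : ℕ) (χ : DirichletCharacter ℂ M) :
    Submodule ℂ (ℍ → ℂ → ℂ) where
  carrier := {φ | φ ∈ jacobiForms k m M χ ∧
    ∃ h, IsThetaDecomposition m φ h ∧ ∀ r, r ≠ 0 → r ≠ m → h r = 0}
  zero_mem' := ⟨Submodule.zero_mem _, 0, ⟨fun _ _ => rfl, fun _ _ => by simp⟩, fun _ _ _ => rfl⟩
  add_mem' := by
    rintro φ ψ ⟨h0, h, ⟨h1, h2⟩, h3⟩ ⟨h0', h', ⟨h1', h2'⟩, h3'⟩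
    refine ⟨Submodule.add_mem _ h0 h0', h + h', ⟨fun r hr => ?_, fun τ z => ?_⟩, fun r hr hr' => ?_⟩
    · rw [Pi.add_apply, h1 r hr, h1' r hr, add_zero]
    · simp only [Pi.add_apply, h2, h2', add_mul, Finset.sum_add_distrib]
    · rw [Pi.add_apply, h3 r hr hr', h3' r hr hr', add_zero]
  smul_mem' := by
    rintro a φ ⟨h0, h, ⟨h1, h2⟩, h3⟩
    refine ⟨Submodule.smul_mem _ a h0, a • h, ⟨fun r hr => ?_, fun τ z => ?_⟩, fun r hr hr' => ?_⟩
    · rw [Pi.smul_apply, h1 r hr, smul_zero]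
    · simp only [Pi.smul_apply, h2, smul_eq_mul, Finset.mul_sum, mul_assoc]
    · rw [Pi.smul_apply, h3 r hr hr', smul_zero]

/-- The restriction map `D_0 : φ ↦ φ(τ,0)`. -/
def restrictZero : (ℍ → ℂ → ℂ) →ₗ[ℂ] (ℍ → ℂ) where
  toFun φ τ := φ τ 0
  map_add' _ _ := rfl
  map_smul' _ _ := rfl

/-- The space `J*_{k,m}(Γ₀(M), χ)⁰ = J*_{k,m}(Γ₀(M), χ) ∩ ker D_0`. -/
def jacobiFormsStarKer (k : ℤ) (m M : ℕ) (χ : DirichletCharacter ℂ M) :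
    Submodule ℂ (ℍ → ℂ → ℂ) :=
  jacobiFormsStar k m M χ ⊓ LinearMap.ker restrictZero

end

end JacobiTheta

/-! The determinant `Δ(τ, z) = θ_{m,m}(τ) θ^J_{m,0}(τ, z) - θ_{m,0}(τ) θ^J_{m,m}(τ, z)` is the
corresponding determinant of index one at `(mτ, mz)`. Since the latter is built from the vector that
`U_1` transforms, `Δ` behaves under `γ ∈ Γ₀(m)` like a Jacobi form of weight one, index `m` and
character `det U_1(γ_m) = ω_m(γ)`, whose values are twelfth roots of unity.

If `φ = h_{m,0} θ^J_{m,0} + h_{m,m} θ^J_{m,m}` vanishes at `z = 0`, then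
`h_{m,0} / θ_{m,m} = -h_{m,m} / θ_{m,0}`; calling this quotient `f`, we get `φ = f Δ`. The division
is legitimate because the Jacobi triple product has no zeros at the relevant points, and `f` is
holomorphic because `Δ(τ, 1/2m) = 2 θ_{m,0}(τ) θ_{m,m}(τ)`.

At a cusp `g∞`, writing `(m 0; 0 1) g = h (A B; 0 D)` with `h ∈ SL₂(ℤ)` expresses `Δ|g` through
the index one determinant at `σ = (Aτ + B) / D`. Its Fourier expansion times that of `f|g` gives the
expansion of `(f Δ)|g`. Conversely, at `z = σ / 2A` the determinant is a nonzero multiple of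
`e(-σ/4)(θ_{1,1}(σ)² - θ_{1,0}(σ)²)`, in which the bracket tends to `-1`, while the Fourier
expansion of `(f Δ)|g` shows that its product with `e(σ/4)` is bounded at that `z`; so `f|g` is
bounded.
-/

namespace JacobiTheta

/-! ### Entire functions of theta type -/

lemma exp_two_pi_I_int (n : ℤ) : cexp (2 * π * I * n) = 1 := by
  rw [mul_comm]
  exact Complex.exp_int_mul_two_pi_mul_I n

/-- The `n`-th Fourier coefficient of a function of period one, computed along the real axis. -/
noncomputable def unitFourierCoeff (f : ℂ → ℂ) (n : ℤ) : ℂ :=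
  ∫ x : ℝ in (0 : ℝ)..1, f x * cexp (-(2 * π * I * (n * x)))

lemma unitFourierCoeff_mul_const (f : ℂ → ℂ) (a : ℂ) (n : ℤ) :
    unitFourierCoeff (fun z => f z * a) n = unitFourierCoeff f n * a := by
  simp only [unitFourierCoeff, ← intervalIntegral.integral_mul_const, mul_right_comm]

lemma unitFourierCoeff_mul_exp (f : ℂ → ℂ) (k n : ℤ) :
    unitFourierCoeff (fun z => f z * cexp (-(2 * π * I * (k * z)))) n =
      unitFourierCoeff f (n + k) := by
  unfold unitFourierCoeff
  congr 1
  ext x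
  rw [mul_assoc, ← Complex.exp_add]
  congr 2
  push_cast
  ring

section Periodic

variable {f : ℂ → ℂ} (hd : Differentiable ℂ f) (hp : Function.Periodic f 1)
include hd hp

lemma intervalIntegral_add_im_mul_I (y : ℝ) :
    ∫ x : ℝ in (0 : ℝ)..1, f (x + y * I) = ∫ x : ℝ in (0 : ℝ)..1, f x := by
  have hsides : ∀ t : ℝ, f (1 + t * I) = f (t * I) := fun t => by rw [add_comm, hp]
  have hrect := Complex.integral_boundary_rect_eq_zero_of_differentiableOn f 0 (1 + y * I)
    hd.differentiableOn
  simp only [add_re, one_re, mul_re, ofReal_re, Complex.I_re, mul_zero, ofReal_im, Complex.I_im,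
    mul_one, sub_self, add_zero, add_im, one_im, mul_im, zero_add, zero_re, zero_im, ofReal_zero,
    zero_mul, ofReal_one, hsides, add_sub_cancel_right] at hrect
  exact (sub_eq_zero.mp hrect).symm

lemma intervalIntegral_add_complex (w : ℂ) :
    ∫ x : ℝ in (0 : ℝ)..1, f (x + w) = ∫ x : ℝ in (0 : ℝ)..1, f x := by
  have hline : Function.Periodic (fun x : ℝ => f (x + w.im * I)) 1 := fun x => by
    simp only [ofReal_add, ofReal_one, add_right_comm _ (1 : ℂ), hp _]
  calc ∫ x : ℝ in (0 : ℝ)..1, f (x + w)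
      = ∫ x : ℝ in (0 : ℝ)..1, f ((x + w.re : ℝ) + w.im * I) := by
        simp only [ofReal_add, add_assoc, Complex.re_add_im]
    _ = ∫ x : ℝ in (0 : ℝ)..1, f (x + w.im * I) := by
        rw [intervalIntegral.integral_comp_add_right (fun x : ℝ => f (x + w.im * I)), zero_add,
          add_comm (1 : ℝ), hline.intervalIntegral_add_eq w.re 0, zero_add]
    _ = ∫ x : ℝ in (0 : ℝ)..1, f x := intervalIntegral_add_im_mul_I hd hp w.im

lemma unitFourierCoeff_comp_add_const (n : ℤ) (w : ℂ) :
    unitFourierCoeff (fun z => f (z + w)) n =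
      unitFourierCoeff f n * cexp (2 * π * I * (n * w)) := by
  have hexp : Function.Periodic (fun z => cexp (-(2 * π * I * (n * z)))) 1 := fun z => by
    simp only
    rw [show -(2 * π * I * (n * (z + 1))) = -(2 * π * I * (n * z)) + 2 * π * I * ((-n : ℤ) : ℂ) by
      push_cast; ring, Complex.exp_add, exp_two_pi_I_int, mul_one]
  have hshift := intervalIntegral_add_complex (f := fun z => f z * cexp (-(2 * π * I * (n * z))))
    (by fun_prop) (hp.mul hexp) w
  unfold unitFourierCoeff
  rw [← hshift, ← intervalIntegral.integral_mul_const]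
  congr 1
  ext x
  rw [mul_assoc (f _), ← Complex.exp_add]
  congr 2
  ring

lemma hasSum_unitFourierCoeff (w : ℂ)
    (hs : Summable fun n : ℤ => unitFourierCoeff f n * cexp (2 * π * I * (n * w))) :
    HasSum (fun n : ℤ => unitFourierCoeff f n * cexp (2 * π * I * (n * w))) (f w) := by
  have hline : Function.Periodic (fun x : ℝ => f (x + w)) 1 := fun x => by
    simp only [ofReal_add, ofReal_one, add_right_comm _ (1 : ℂ), hp _]
  let F : C(AddCircle (1 : ℝ), ℂ) := ⟨hline.lift, continuous_coinduced_dom.mpr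
    (hd.continuous.comp (by fun_prop : Continuous fun x : ℝ => (x : ℂ) + w))⟩
  have hF : ∀ x : ℝ, F x = f (x + w) := fun _ => rfl
  have hcoeff : fourierCoeff F = fun n => unitFourierCoeff f n * cexp (2 * π * I * (n * w)) := by
    ext n
    rw [← unitFourierCoeff_comp_add_const hd hp, fourierCoeff_eq_intervalIntegral F n 0]
    simp only [div_one, zero_add, one_smul, unitFourierCoeff]
    congr 1
    ext x
    rw [hF, fourier_coe_apply, smul_eq_mul, mul_comm]
    congr 2
    push_cast
    ring
  have hsum := has_pointwise_sum_fourier_series_of_summable (f := F) (by rwa [hcoeff]) (0 : ℝ)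
  simpa only [hF, hcoeff, fourier_coe_apply, ofReal_zero, mul_zero, zero_div, Complex.exp_zero,
    smul_eq_mul, mul_one, zero_add] using hsum

end Periodic

/-- The theta series `∑_{n ≡ r mod M} e(n² τ / 2M + n z)`. -/
noncomputable def thetaSeries (M r : ℕ) (τ z : ℂ) : ℂ :=
  ∑' j : ℤ, cexp (2 * π * I * ((r + M * j) ^ 2 * τ / (2 * M) + (r + M * j) * z))

lemma thetaSeries_one_zero (τ z : ℂ) : thetaSeries 1 0 τ z = jacobiTheta₂ z τ := by
  unfold thetaSeries jacobiTheta₂ jacobiTheta₂_term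
  congr 1
  ext j
  congr 1
  push_cast
  ring

lemma thetaSeries_two_mul {m : ℕ} (hm : 0 < m) (r : ℕ) (τ : ℍ) (z : ℂ) :
    thetaSeries (2 * m) r τ z = thetaJ m r τ z := by
  have hmc : (m : ℂ) ≠ 0 := by exact_mod_cast hm.ne'
  unfold thetaSeries thetaJ
  congr 1
  ext j
  congr 1
  push_cast
  field_simp
  ring

/-- The Fourier coefficients of a function of theta type, normalised so as to be periodic modulo
`M`. -/
noncomputable def thetaCoeff (M : ℕ) (τ : ℂ) (f : ℂ → ℂ) (n : ℤ) : ℂ :=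
  unitFourierCoeff f n * cexp (-(2 * π * I * (n ^ 2 * τ / (2 * M))))

lemma unitFourierCoeff_mul_exp_eq_thetaCoeff_mul {M : ℕ} (hM : 0 < M) (τ : ℂ) (f : ℂ → ℂ) (n : ℤ)
    (w : ℂ) : unitFourierCoeff f n * cexp (2 * π * I * (n * w)) =
      thetaCoeff M τ f n * jacobiTheta₂_term n w (τ / M) := by
  have hMc : (M : ℂ) ≠ 0 := by exact_mod_cast hM.ne'
  rw [thetaCoeff, jacobiTheta₂_term, mul_assoc (unitFourierCoeff f n), ← Complex.exp_add]
  congr 2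
  field_simp
  ring

lemma exists_norm_le_of_periodic {b : ℤ → ℂ} {M : ℕ} (hM : 0 < M)
    (hb : Function.Periodic b (M : ℤ)) : ∃ C, ∀ n, ‖b n‖ ≤ C := by
  obtain ⟨C, hC⟩ := (((Set.finite_Ico (0 : ℤ) (0 + M)).image b).isBounded).exists_norm_le
  refine ⟨C, fun n => hC _ ?_⟩
  obtain ⟨l, hl, hnl⟩ := hb.exists_mem_Ico (by exact_mod_cast hM) n 0
  exact ⟨l, hl, hnl.symm⟩

section ThetaType

variable {M : ℕ} (hM : 0 < M) {τ : ℂ} {f : ℂ → ℂ}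
  (hd : Differentiable ℂ f) (hp : Function.Periodic f 1)
  (hq : ∀ z, f (z + τ) = cexp (-(2 * π * I * (M * τ / 2 + M * z))) * f z)
include hM hd hp hq

lemma periodic_thetaCoeff : Function.Periodic (thetaCoeff M τ f) (M : ℤ) := fun n => by
  have hMc : (M : ℂ) ≠ 0 := by exact_mod_cast hM.ne'
  have hshift : (fun z => f (z + τ)) =
      fun z => f z * cexp (-(2 * π * I * ((M : ℤ) * z))) * cexp (-(2 * π * I * (M * τ / 2))) := by
    ext z
    rw [hq, mul_comm, mul_assoc (f z), ← Complex.exp_add]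
    congr 2
    push_cast
    ring
  have hrec : unitFourierCoeff f n * cexp (2 * π * I * (n * τ)) =
      unitFourierCoeff f (n + M) * cexp (-(2 * π * I * (M * τ / 2))) := by
    rw [← unitFourierCoeff_comp_add_const hd hp, hshift, unitFourierCoeff_mul_const,
      unitFourierCoeff_mul_exp]
  calc thetaCoeff M τ f (n + M)
      = unitFourierCoeff f (n + M) * cexp (-(2 * π * I * (M * τ / 2))) *
          cexp (-(2 * π * I * (n ^ 2 * τ / (2 * M) + n * τ))) := by
        rw [thetaCoeff, mul_assoc (unitFourierCoeff f _), ← Complex.exp_add]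
        congr 2
        push_cast
        field_simp
        ring
    _ = thetaCoeff M τ f n := by
        rw [← hrec, thetaCoeff, mul_assoc (unitFourierCoeff f n), ← Complex.exp_add]
        congr 2
        ring

lemma thetaCoeff_add_mul (r : ℕ) (j : ℤ) :
    thetaCoeff M τ f (r + M * j) = thetaCoeff M τ f r := by
  rw [mul_comm]
  exact (periodic_thetaCoeff hM hd hp hq).int_mul j r

lemma hasSum_thetaCoeff_mul (hτ : 0 < τ.im) (z : ℂ) :
    HasSum (fun n => thetaCoeff M τ f n * jacobiTheta₂_term n z (τ / M)) (f z) := by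
  have hτM : 0 < (τ / M).im := by
    rw [Complex.div_natCast_im]
    positivity
  obtain ⟨C, hC⟩ := exists_norm_le_of_periodic hM (periodic_thetaCoeff hM hd hp hq)
  have hs : Summable fun n => thetaCoeff M τ f n * jacobiTheta₂_term n z (τ / M) := by
    refine .of_norm_bounded (((summable_jacobiTheta₂_term_iff z _).mpr hτM).norm.mul_left C)
      fun n => ?_
    rw [norm_mul]
    exact mul_le_mul_of_nonneg_right (hC n) (norm_nonneg _)
  simp only [← unitFourierCoeff_mul_exp_eq_thetaCoeff_mul hM] at hs ⊢
  exact hasSum_unitFourierCoeff hd hp z hs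

lemma eq_sum_thetaSeries (hτ : 0 < τ.im) (z : ℂ) :
    f z = ∑ r ∈ Finset.range M, thetaCoeff M τ f r * thetaSeries M r τ z := by
  have hMc : (M : ℂ) ≠ 0 := by exact_mod_cast hM.ne'
  have : NeZero M := ⟨hM.ne'⟩
  have hsum := hasSum_thetaCoeff_mul hM hd hp hq hτ z
  rw [← ((Equiv.prodComm _ _).trans (Int.divModEquiv M).symm).hasSum_iff] at hsum
  rw [(hsum.prod_fiberwise fun r => (hsum.summable.prod_factor r).hasSum).unique
    (hasSum_fintype _), Finset.sum_range]
  refine Finset.sum_congr rfl fun r _ => ?_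
  rw [thetaSeries, ← tsum_mul_left]
  refine tsum_congr fun j => ?_
  simp only [Function.comp_apply, Equiv.trans_apply, Equiv.prodComm_apply, Prod.swap_prod_mk,
    Int.divModEquiv_symm_apply]
  rw [mul_comm j, add_comm, thetaCoeff_add_mul hM hd hp hq, jacobiTheta₂_term]
  congr 2
  push_cast
  field_simp
  ring

end ThetaType

/-! ### Zeros of the theta constants -/

/-- The infinite product `∏_{n ≥ 0} (1 + q^{2n+1} w)`, one of the two variable factors of the Jacobi
triple product. -/
noncomputable def oddProd (q w : ℂ) : ℂ := ∏' n : ℕ, (1 + q ^ (2 * n + 1) * w)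

section OddProd

variable {q : ℂ} (hq : ‖q‖ < 1)
include hq

lemma summable_norm_odd_pow_mul (w : ℂ) : Summable fun n : ℕ => ‖q ^ (2 * n + 1) * w‖ := by
  have hinj : Function.Injective fun n : ℕ => 2 * n + 1 := fun a b hab => by simpa using hab
  simpa only [norm_mul, norm_pow, Function.comp_def] using
    ((summable_geometric_of_lt_one (norm_nonneg q) hq).comp_injective hinj).mul_right ‖w‖

lemma oddProd_eq_mul (w : ℂ) : oddProd q w = (1 + q * w) * oddProd q (q ^ 2 * w) := by
  have htail : Multipliable fun n : ℕ => 1 + q ^ (2 * (n + 1) + 1) * w :=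
    multipliable_one_add_of_summable
      ((summable_nat_add_iff (f := fun n : ℕ => ‖q ^ (2 * n + 1) * w‖) 1).mpr
        (summable_norm_odd_pow_mul hq w))
  unfold oddProd
  rw [tprod_eq_zero_mul' (f := fun n : ℕ => 1 + q ^ (2 * n + 1) * w) htail]
  congr 1
  · simp
  · exact tprod_congr fun n => by ring

lemma oddProd_ne_zero {w : ℂ} (hw : ‖w‖ ≤ 1) : oddProd q w ≠ 0 := by
  refine tprod_one_add_ne_zero_of_summable (fun n h => ?_) (summable_norm_odd_pow_mul hq w)
  have hlt : ‖q ^ (2 * n + 1) * w‖ < 1 := by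
    rw [norm_mul, norm_pow]
    exact mul_lt_one_of_nonneg_of_lt_one_left (by positivity)
      (pow_lt_one₀ (norm_nonneg q) hq (by omega)) hw
  rw [← neg_eq_of_add_eq_zero_right h, norm_neg, norm_one] at hlt
  exact lt_irrefl _ hlt

lemma differentiable_oddProd : Differentiable ℂ (oddProd q) := by
  intro w₀
  have hopen : IsOpen (Metric.ball (0 : ℂ) (‖w₀‖ + 1)) := Metric.isOpen_ball
  have hprod := (summable_norm_odd_pow_mul hq ((‖w₀‖ + 1 : ℝ) : ℂ)
    ).hasProdLocallyUniformlyOn_nat_one_add (f := fun n w => q ^ (2 * n + 1) * w) hopen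
    (.of_forall fun n w hw => by
      rw [norm_mul, norm_mul, Complex.norm_real, Real.norm_eq_abs, abs_of_nonneg (by positivity)]
      gcongr
      exact (mem_ball_zero_iff.mp hw).le)
    (fun n => by fun_prop)
  have hdiff : DifferentiableOn ℂ (oddProd q) (Metric.ball (0 : ℂ) (‖w₀‖ + 1)) :=
    hprod.differentiableOn (.of_forall fun _ => by
      simpa [Finset.prod_fn] using DifferentiableOn.finsetProd (fun _ _ => by fun_prop)) hopen
  exact hdiff.differentiableAt (hopen.mem_nhds (by simp))

end OddProd

/-- The product `∏_{n ≥ 0} (1 + q^{2n+1} e(z)) (1 + q^{2n+1} e(-z))` with `q = e(τ/2)`, that is, the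
Jacobi triple product without its constant factor. -/
noncomputable def jacobiProd (τ z : ℂ) : ℂ :=
  oddProd (cexp (π * I * τ)) (cexp (2 * π * I * z)) *
    oddProd (cexp (π * I * τ)) (cexp (-(2 * π * I * z)))

section JacobiProd

variable {τ : ℂ} (hτ : 0 < τ.im)

lemma periodic_jacobiProd : Function.Periodic (jacobiProd τ) 1 := fun z => by
  have hexp : cexp (2 * π * I * (z + 1)) = cexp (2 * π * I * z) := by
    rw [mul_add, Complex.exp_add, mul_one, Complex.exp_two_pi_mul_I, mul_one]
  simp only [jacobiProd, Complex.exp_neg, hexp]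

include hτ

lemma norm_exp_pi_mul_I_mul_lt_one : ‖cexp (π * I * τ)‖ < 1 := by
  have hre : (π * I * τ : ℂ).re = -(π * τ.im) := by simp
  rw [Complex.norm_exp, Real.exp_lt_one_iff, hre]
  exact neg_neg_of_pos (mul_pos Real.pi_pos hτ)

lemma differentiable_jacobiProd : Differentiable ℂ (jacobiProd τ) := by
  have h := differentiable_oddProd (norm_exp_pi_mul_I_mul_lt_one hτ)
  exact (h.comp (by fun_prop)).mul (h.comp (by fun_prop))

lemma jacobiProd_add_self (z : ℂ) : jacobiProd τ (z + τ) =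
    cexp (-(2 * π * I * ((1 : ℕ) * τ / 2 + (1 : ℕ) * z))) * jacobiProd τ z := by
  have hq := norm_exp_pi_mul_I_mul_lt_one hτ
  unfold jacobiProd
  set q := cexp (π * I * τ) with hqdef
  have hfst : cexp (2 * π * I * (z + τ)) = q ^ 2 * cexp (2 * π * I * z) := by
    rw [hqdef, ← Complex.exp_nat_mul, ← Complex.exp_add]; congr 1; push_cast; ring
  have hsnd : q ^ 2 * cexp (-(2 * π * I * (z + τ))) = cexp (-(2 * π * I * z)) := by
    rw [hqdef, ← Complex.exp_nat_mul, ← Complex.exp_add]; congr 1; push_cast; ring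
  have hmult : q * cexp (-(2 * π * I * (z + τ))) =
      cexp (-(2 * π * I * ((1 : ℕ) * τ / 2 + (1 : ℕ) * z))) := by
    rw [hqdef, ← Complex.exp_add]; congr 1; push_cast; ring
  have hcancel : cexp (-(2 * π * I * ((1 : ℕ) * τ / 2 + (1 : ℕ) * z))) *
      (q * cexp (2 * π * I * z)) = 1 := by
    rw [hqdef, ← Complex.exp_add, ← Complex.exp_add, ← Complex.exp_zero]
    congr 1; push_cast; ring
  rw [oddProd_eq_mul hq (cexp (-(2 * π * I * (z + τ)))), hsnd, hfst, hmult,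
    oddProd_eq_mul hq (cexp (2 * π * I * z))]
  linear_combination -(oddProd q (q ^ 2 * cexp (2 * π * I * z)) *
    oddProd q (cexp (-(2 * π * I * z)))) * hcancel

lemma exists_jacobiProd_eq_mul_jacobiTheta₂ : ∃ b : ℂ, ∀ z,
    jacobiProd τ z = b * jacobiTheta₂ z τ := by
  refine ⟨thetaCoeff 1 τ (jacobiProd τ) 0, fun z => ?_⟩
  rw [eq_sum_thetaSeries one_pos (differentiable_jacobiProd hτ) periodic_jacobiProd
    (jacobiProd_add_self hτ) hτ z, Finset.sum_range_one, thetaSeries_one_zero, Nat.cast_zero]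

lemma jacobiTheta₂_ne_zero_of_jacobiProd {z : ℂ} (h : jacobiProd τ z ≠ 0) :
    jacobiTheta₂ z τ ≠ 0 := by
  obtain ⟨b, hb⟩ := exists_jacobiProd_eq_mul_jacobiTheta₂ hτ
  exact right_ne_zero_of_mul (hb z ▸ h)

lemma jacobiTheta₂_zero_ne_zero : jacobiTheta₂ 0 τ ≠ 0 := by
  have h := oddProd_ne_zero (norm_exp_pi_mul_I_mul_lt_one hτ) norm_one.le
  refine jacobiTheta₂_ne_zero_of_jacobiProd hτ ?_
  simpa only [jacobiProd, mul_zero, neg_zero, Complex.exp_zero] using mul_ne_zero h h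

lemma jacobiTheta₂_half_ne_zero : jacobiTheta₂ (τ / 2) τ ≠ 0 := by
  have hq := norm_exp_pi_mul_I_mul_lt_one hτ
  have hq0 : cexp (π * I * τ) ≠ 0 := Complex.exp_ne_zero _
  refine jacobiTheta₂_ne_zero_of_jacobiProd hτ ?_
  rw [jacobiProd, Complex.exp_neg, show 2 * π * I * (τ / 2) = π * I * τ by ring,
    oddProd_eq_mul hq _⁻¹, mul_inv_cancel₀ hq0, pow_two,
    mul_assoc (cexp _), mul_inv_cancel₀ hq0, mul_one]
  have h := oddProd_ne_zero hq hq.le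
  exact mul_ne_zero h (mul_ne_zero (by norm_num) h)

end JacobiProd

section ThetaConstants

variable {m : ℕ} (hm : 0 < m)
include hm

lemma im_two_mul_pos (τ : ℍ) : 0 < (2 * m * (τ : ℂ)).im := by
  have := τ.im_pos
  rw [show (2 * m * (τ : ℂ)).im = 2 * m * τ.im by simp]
  positivity

lemma thetaJ_eq_exp_mul_jacobiTheta₂ (r : ℕ) (τ : ℍ) (z : ℂ) :
    thetaJ m r τ z = cexp (2 * π * I * (r ^ 2 / (4 * m) * τ + r * z)) *
      jacobiTheta₂ (r * τ + 2 * m * z) (2 * m * τ) := by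
  have hmc : (m : ℂ) ≠ 0 := by exact_mod_cast hm.ne'
  unfold thetaJ jacobiTheta₂ jacobiTheta₂_term
  rw [← tsum_mul_left]
  congr 1
  ext n
  rw [← Complex.exp_add]
  congr 1
  field_simp
  ring

lemma theta_zero_ne_zero (τ : ℍ) : theta m 0 τ ≠ 0 := by
  rw [theta, thetaJ_eq_exp_mul_jacobiTheta₂ hm]
  refine mul_ne_zero (Complex.exp_ne_zero _) ?_
  simpa using jacobiTheta₂_zero_ne_zero (im_two_mul_pos hm τ)

lemma theta_self_ne_zero (τ : ℍ) : theta m m τ ≠ 0 := by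
  rw [theta, thetaJ_eq_exp_mul_jacobiTheta₂ hm]
  refine mul_ne_zero (Complex.exp_ne_zero _) ?_
  convert jacobiTheta₂_half_ne_zero (im_two_mul_pos hm τ) using 2
  ring

end ThetaConstants

/-! ### The theta decomposition -/

section ThetaDecomposition

variable {m : ℕ} (hm : 0 < m)
include hm

lemma thetaJ_add_natCast_div (r j : ℕ) (τ : ℍ) (z : ℂ) :
    thetaJ m r τ (z + j / (2 * m)) =
      cexp (2 * π * I * (r / (2 * m : ℕ))) ^ j * thetaJ m r τ z := by
  have hmc : (m : ℂ) ≠ 0 := by exact_mod_cast hm.ne'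
  unfold thetaJ
  rw [← tsum_mul_left]
  congr 1
  ext n
  rw [← Complex.exp_nat_mul, ← one_mul (cexp _ * cexp _), ← exp_two_pi_I_int (n * j),
    ← Complex.exp_add, ← Complex.exp_add]
  congr 1
  push_cast
  field_simp
  ring

lemma exists_thetaJ_ne_zero (r : ℕ) (τ : ℍ) : ∃ z, thetaJ m r τ z ≠ 0 := by
  have hmc : (m : ℂ) ≠ 0 := by exact_mod_cast hm.ne'
  refine ⟨-(r * τ / (2 * m)), ?_⟩
  rw [thetaJ_eq_exp_mul_jacobiTheta₂ hm,
    show (r * τ + 2 * m * -(r * τ / (2 * m)) : ℂ) = 0 by field_simp; ring]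
  exact mul_ne_zero (Complex.exp_ne_zero _) (jacobiTheta₂_zero_ne_zero (im_two_mul_pos hm τ))

lemma exp_two_pi_I_div_injective :
    Function.Injective fun r : Fin m => cexp (2 * π * I * ((r : ℕ) / m)) := by
  have hpow : ∀ r : ℕ, cexp (2 * π * I * (r / m)) = cexp (2 * π * I / m) ^ r := fun r => by
    rw [← Complex.exp_nat_mul]
    congr 1
    ring
  intro r s h
  simp only [hpow] at h
  exact Fin.ext ((Complex.isPrimitiveRoot_exp m hm.ne').pow_inj r.2 s.2 h)

-- The `θ^J_{m,r}(τ, ·)` are eigenfunctions of `z ↦ z + 1/2m` for distinct eigenvalues.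
lemma eq_zero_of_sum_mul_thetaJ_eq_zero (τ : ℍ) {a : ℕ → ℂ}
    (h : ∀ z, ∑ r ∈ Finset.range (2 * m), a r * thetaJ m r τ z = 0) {r : ℕ} (hr : r < 2 * m) :
    a r = 0 := by
  obtain ⟨z, hz⟩ := exists_thetaJ_ne_zero hm r τ
  have hvec : (fun r : Fin (2 * m) => a r * thetaJ m r τ z) = 0 := by
    refine Matrix.eq_zero_of_forall_pow_sum_mul_pow_eq_zero
      (exp_two_pi_I_div_injective (by omega)) fun j => ?_
    rw [← h (z + (j : ℕ) / (2 * m)), Finset.sum_range]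
    refine Finset.sum_congr rfl fun s _ => ?_
    rw [thetaJ_add_natCast_div hm]
    ring
  exact (mul_eq_zero.mp (congrFun hvec ⟨r, hr⟩)).resolve_right hz

lemma IsThetaDecomposition.unique {φ : ℍ → ℂ → ℂ} {h h' : ℕ → ℍ → ℂ}
    (H : IsThetaDecomposition m φ h) (H' : IsThetaDecomposition m φ h') : h = h' := by
  funext r τ
  by_cases hr : r < 2 * m
  · refine sub_eq_zero.mp (eq_zero_of_sum_mul_thetaJ_eq_zero hm τ (a := fun r => h r τ - h' r τ)
      (fun z => ?_) hr)
    simp only [sub_mul, Finset.sum_sub_distrib]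
    rw [← H.2, ← H'.2, sub_self]
  · rw [H.1 r (by omega), H'.1 r (by omega)]

lemma exists_isThetaDecomposition {φ : ℍ → ℂ → ℂ} (hd : ∀ τ, Differentiable ℂ (φ τ))
    (hell : ∀ (l μ : ℤ) (τ : ℍ) (z : ℂ), φ τ (z + l * τ + μ) =
      cexp (-(2 * π * I * (m * (l ^ 2 * τ + 2 * l * z)))) * φ τ z) :
    ∃ h, IsThetaDecomposition m φ h := by
  have hper (τ : ℍ) : Function.Periodic (φ τ) 1 := fun z => by simpa using hell 0 1 τ z
  have hquasi (τ : ℍ) (z : ℂ) : φ τ (z + τ) =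
      cexp (-(2 * π * I * ((2 * m : ℕ) * τ / 2 + (2 * m : ℕ) * z))) * φ τ z := by
    have h := hell 1 0 τ z
    rw [Int.cast_one, one_mul, Int.cast_zero, add_zero] at h
    rw [h]
    congr 2
    push_cast
    ring
  refine ⟨fun r τ => if r < 2 * m then thetaCoeff (2 * m) τ (φ τ) r else 0,
    fun r hr => funext fun τ => if_neg (not_lt.mpr hr), fun τ z => ?_⟩
  rw [eq_sum_thetaSeries (M := 2 * m) (by omega) (hd τ) (hper τ) (hquasi τ) τ.im_pos z]
  refine Finset.sum_congr rfl fun r hr => ?_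
  simp only [if_pos (Finset.mem_range.mp hr), thetaSeries_two_mul hm]

lemma sum_range_two_mul_eq {a : ℕ → ℂ} (ha : ∀ r, r ≠ 0 → r ≠ m → a r = 0) :
    ∑ r ∈ Finset.range (2 * m), a r = a 0 + a m := by
  rw [← Finset.sum_pair hm.ne]
  refine (Finset.sum_subset (fun r hr => ?_) fun r _ hr => ha r ?_ ?_).symm
  · simp only [Finset.mem_insert, Finset.mem_singleton] at hr
    exact Finset.mem_range.mpr (by omega)
  all_goals exact fun h => hr (by simp [h])

end ThetaDecomposition

lemma IsHolomorphic.differentiable {φ : ℍ → ℂ → ℂ} (h : IsHolomorphic φ) (τ : ℍ) :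
    Differentiable ℂ (φ τ) := by
  intro z
  have hopen : IsOpen {p : ℂ × ℂ | 0 < p.1.im} :=
    isOpen_lt continuous_const (Complex.continuous_im.comp continuous_fst)
  have hpair : DifferentiableAt ℂ (fun p : ℂ × ℂ => φ (ofComplex p.1) p.2) ((τ : ℂ), z) :=
    h.differentiableAt (hopen.mem_nhds τ.im_pos)
  have hslice := hpair.comp z ((differentiableAt_const (τ : ℂ)).prodMk differentiableAt_id)
  simpa only [Function.comp_def, id_eq, ofComplex_apply] using hslice

/-! ### The determinant of theta series -/

/-- The determinant `θ_{m,m}(τ) θ^J_{m,0}(τ,z) - θ_{m,0}(τ) θ^J_{m,m}(τ,z)`, by which the inverse of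
`Λ_m^*` multiplies a modular form. -/
noncomputable def thetaDet (m : ℕ) (τ : ℍ) (z : ℂ) : ℂ :=
  theta m m τ * thetaJ m 0 τ z - theta m 0 τ * thetaJ m m τ z

lemma thetaDet_zero (m : ℕ) (τ : ℍ) : thetaDet m τ 0 = 0 := by
  rw [thetaDet, ← theta, ← theta, mul_comm, sub_self]

lemma IsThetaMatrix.thetaDet_smul {γ : SL(2, ℤ)} {U : Matrix (Fin 2) (Fin 2) ℂ}
    (h : IsThetaMatrix γ U) (τ : ℍ) (z : ℂ) :
    thetaDet 1 (γ • τ) (z / denom γ τ) =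
      cexp (2 * π * I * ((γ 1 0 : ℤ) * z ^ 2 / denom γ τ)) * denom γ τ * U.det *
        thetaDet 1 τ z := by
  have hz0 := h τ z 0
  have hz1 := h τ z 1
  have h00 := h τ 0 0
  have h01 := h τ 0 1
  simp only [Matrix.mulVec, dotProduct, Fin.sum_univ_two, Fin.val_zero, Fin.val_one, zero_div,
    ne_eq, OfNat.ofNat_ne_zero, not_false_eq_true, zero_pow, mul_zero, Complex.exp_zero,
    one_mul] at h00 h01 hz0 hz1
  simp only [thetaDet, theta, h00, h01, hz0, hz1, Matrix.det_fin_two]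
  linear_combination (cexp (2 * π * I * ((γ 1 0 : ℤ) * z ^ 2 / denom γ τ)) *
    (U 0 0 * U 1 1 - U 0 1 * U 1 0) * (thetaJ 1 1 τ 0 * thetaJ 1 0 τ z -
      thetaJ 1 0 τ 0 * thetaJ 1 1 τ z)) * sqrt_sq (denom γ τ)

section PositiveIndex

variable {m : ℕ} (hm : 0 < m)
include hm

lemma thetaJ_zero_eq_index_one {τ σ : ℍ} (h : (σ : ℂ) = m * τ) (z : ℂ) :
    thetaJ m 0 τ z = thetaJ 1 0 σ (m * z) := by
  have hmc : (m : ℂ) ≠ 0 := by exact_mod_cast hm.ne'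
  unfold thetaJ
  rw [h]
  congr 1; ext n; congr 1; push_cast; field_simp; ring

lemma thetaJ_self_eq_index_one {τ σ : ℍ} (h : (σ : ℂ) = m * τ) (z : ℂ) :
    thetaJ m m τ z = thetaJ 1 1 σ (m * z) := by
  have hmc : (m : ℂ) ≠ 0 := by exact_mod_cast hm.ne'
  unfold thetaJ
  rw [h]
  congr 1; ext n; congr 1; push_cast; field_simp

lemma thetaDet_eq_index_one {τ σ : ℍ} (h : (σ : ℂ) = m * τ) (z : ℂ) :
    thetaDet m τ z = thetaDet 1 σ (m * z) := by
  simp only [thetaDet, theta, thetaJ_zero_eq_index_one hm h, thetaJ_self_eq_index_one hm h,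
    mul_zero]

lemma thetaDet_inv_two_mul (τ : ℍ) :
    thetaDet m τ (1 / (2 * m)) = 2 * theta m 0 τ * theta m m τ := by
  have hmc : (m : ℂ) ≠ 0 := by exact_mod_cast hm.ne'
  have hsign : cexp (2 * π * I * (m / (2 * m : ℕ))) = -1 := by
    rw [← Complex.exp_pi_mul_I]; congr 1; push_cast; field_simp
  have hzero : thetaJ m 0 τ (1 / (2 * m)) = theta m 0 τ := by
    simpa [theta] using thetaJ_add_natCast_div hm 0 1 τ 0
  have hself : thetaJ m m τ (1 / (2 * m)) = -theta m m τ := by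
    have h := thetaJ_add_natCast_div hm m 1 τ 0
    rwa [hsign, Nat.cast_one, zero_add, pow_one, neg_one_mul] at h
  rw [thetaDet, hzero, hself]
  ring

lemma thetaDet_inv_two_mul_ne_zero (τ : ℍ) : thetaDet m τ (1 / (2 * m)) ≠ 0 := by
  rw [thetaDet_inv_two_mul hm]
  exact mul_ne_zero (mul_ne_zero two_ne_zero (theta_zero_ne_zero hm τ)) (theta_self_ne_zero hm τ)

lemma thetaJ_elliptic (r : ℕ) (l μ : ℤ) (τ : ℍ) (z : ℂ) :
    thetaJ m r τ (z + l * τ + μ) =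
      cexp (-(2 * π * I * (m * (l ^ 2 * τ + 2 * l * z)))) * thetaJ m r τ z := by
  have hmc : (m : ℂ) ≠ 0 := by exact_mod_cast hm.ne'
  unfold thetaJ
  rw [← tsum_mul_left, ← (Equiv.addRight l).tsum_eq (fun n : ℤ => cexp _ * cexp _)]
  congr 1
  ext n
  rw [← one_mul (cexp _ * cexp _), ← exp_two_pi_I_int ((2 * m * n + r) * μ),
    ← Complex.exp_add, ← Complex.exp_add, Equiv.coe_addRight]
  congr 1
  push_cast
  field_simp
  ring

lemma thetaDet_elliptic (l μ : ℤ) (τ : ℍ) (z : ℂ) :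
    thetaDet m τ (z + l * τ + μ) =
      cexp (-(2 * π * I * (m * (l ^ 2 * τ + 2 * l * z)))) * thetaDet m τ z := by
  simp only [thetaDet, thetaJ_elliptic hm]
  ring

lemma isHolomorphic_thetaJ (r : ℕ) : IsHolomorphic (thetaJ m r) := by
  have hprod : DifferentiableOn ℂ (fun p : ℂ × ℂ =>
      cexp (2 * π * I * (r ^ 2 / (4 * m) * p.1 + r * p.2)) *
        jacobiTheta₂ (r * p.1 + 2 * m * p.2) (2 * m * p.1)) {p | 0 < p.1.im} := by
    intro p hp
    have htheta : DifferentiableAt ℂ (fun p : ℂ × ℂ => jacobiTheta₂ p.1 p.2)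
        (r * p.1 + 2 * m * p.2, 2 * m * p.1) :=
      (hasFDerivAt_jacobiTheta₂ _ (im_two_mul_pos hm ⟨p.1, hp⟩)).differentiableAt
    have hcomp := htheta.comp p (f := fun p : ℂ × ℂ => (r * p.1 + 2 * m * p.2, 2 * m * p.1))
      (by fun_prop)
    exact (DifferentiableAt.mul (by fun_prop) hcomp).differentiableWithinAt
  refine hprod.congr fun p hp => ?_
  rw [thetaJ_eq_exp_mul_jacobiTheta₂ hm, ofComplex_apply_of_im_pos hp]

lemma isHolomorphic_thetaDet : IsHolomorphic (thetaDet m) := by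
  have hconst (r : ℕ) : DifferentiableOn ℂ (fun p : ℂ × ℂ => theta m r (ofComplex p.1))
      {p | 0 < p.1.im} :=
    DifferentiableOn.comp (t := {p : ℂ × ℂ | 0 < p.1.im}) (isHolomorphic_thetaJ hm r)
      (f := fun p : ℂ × ℂ => (p.1, (0 : ℂ))) (by fun_prop) fun p hp => hp
  exact ((hconst m).mul (isHolomorphic_thetaJ hm 0)).sub
    ((hconst 0).mul (isHolomorphic_thetaJ hm m))

end PositiveIndex

/-! ### Transformation under the modular group -/

/-- A factorization `(m 0; 0 1) g = h (A B; 0 D)` with `h ∈ SL₂(ℤ)`, which reduces the behaviour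
of index `m` theta functions at the cusp `g∞` to the index one theta functions at `i∞`. -/
structure CuspFactorization (m : ℕ) (g : SL(2, ℤ)) where
  left : SL(2, ℤ)
  A : ℕ
  B : ℤ
  D : ℕ
  A_pos : 0 < A
  D_pos : 0 < D
  diag_mul : !![(m : ℤ), 0; 0, 1] * (g : Matrix (Fin 2) (Fin 2) ℤ) =
    (left : Matrix (Fin 2) (Fin 2) ℤ) * !![(A : ℤ), B; 0, (D : ℤ)]

lemma diag_mul_eq_mul_upper_iff {m A B D : ℤ} {g g' : Matrix (Fin 2) (Fin 2) ℤ} :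
    !![m, 0; 0, 1] * g = g' * !![A, B; 0, D] ↔
      (m * g 0 0 = g' 0 0 * A ∧ m * g 0 1 = g' 0 0 * B + g' 0 1 * D) ∧
        g 1 0 = g' 1 0 * A ∧ g 1 1 = g' 1 0 * B + g' 1 1 * D := by
  rw [← Matrix.ext_iff]
  simp [Fin.forall_fin_two, Matrix.mul_apply]

namespace CuspFactorization

-- `A` is the greatest common divisor of the first column of `(m 0; 0 1) g`.
lemma nonempty {m : ℕ} (hm : 0 < m) (g : SL(2, ℤ)) : Nonempty (CuspFactorization m g) := by
  have hm' : (0 : ℤ) < m := by exact_mod_cast hm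
  have hdet : g 0 0 * g 1 1 - g 0 1 * g 1 0 = 1 := by
    rw [← Matrix.det_fin_two, g.det_coe]
  have hgcd : 0 < Int.gcd (m * g 0 0) (g 1 0) := by
    refine Nat.pos_of_ne_zero fun h => ?_
    obtain ⟨h0, h1⟩ := Int.gcd_eq_zero_iff.mp h
    rw [(mul_eq_zero.mp h0).resolve_left hm'.ne', h1] at hdet
    simp at hdet
  obtain ⟨x, y, hxy, hx, hy⟩ := Int.exists_gcd_one hgcd
  obtain ⟨u, v, huv⟩ := Int.isCoprime_iff_gcd_eq_one.mpr hxy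
  set A := Int.gcd (m * g 0 0) (g 1 0)
  have hAD : (A : ℤ) * (-(y * (m * g 0 1)) + x * g 1 1) = m := by
    linear_combination m * hdet - g 1 1 * hx + m * g 0 1 * hy
  have hD : 0 < -(y * (m * g 0 1)) + x * g 1 1 :=
    pos_of_mul_pos_right (hm'.trans_eq hAD.symm) (Int.natCast_nonneg A)
  refine ⟨⟨⟨!![x, -v; y, u], by rw [Matrix.det_fin_two_of]; linear_combination huv⟩, A,
    u * (m * g 0 1) + v * g 1 1, (-(y * (m * g 0 1)) + x * g 1 1).toNat, hgcd, by omega,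
    diag_mul_eq_mul_upper_iff.mpr ?_⟩⟩
  simp only [Int.toNat_of_nonneg hD.le, Matrix.of_apply, Matrix.cons_val', Matrix.cons_val_zero,
    Matrix.cons_val_one, Matrix.cons_val_fin_one]
  exact ⟨⟨hx, by linear_combination -m * g 0 1 * huv⟩, hy, by linear_combination -g 1 1 * huv⟩

/-- The factorization `(m 0; 0 1) γ = γ_m (m 0; 0 1)` for `γ ∈ Γ₀(m)`. -/
def ofGamma0 {m : ℕ} (hm : 0 < m) (γ : CongruenceSubgroup.Gamma0 m) : CuspFactorization m γ where
  left := conjByIndex m γ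
  A := m
  B := 0
  D := 1
  A_pos := hm
  D_pos := one_pos
  diag_mul := diag_mul_eq_mul_upper_iff.mpr (by
    simp [conjByIndex, mul_comm, Int.mul_ediv_cancel' (dvd_of_mem_Gamma0 γ)])

variable {m : ℕ} {g : SL(2, ℤ)} (F : CuspFactorization m g)

lemma index_eq : (m : ℂ) = F.A * F.D := by
  have h := congrArg Matrix.det F.diag_mul
  simp only [Matrix.det_mul, Matrix.SpecialLinearGroup.det_coe, Matrix.det_fin_two_of] at h
  have h' : m = F.A * F.D := by zify; linear_combination h
  exact_mod_cast h'

lemma A_ne_zero : (F.A : ℂ) ≠ 0 := by exact_mod_cast F.A_pos.ne'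

lemma D_ne_zero : (F.D : ℂ) ≠ 0 := by exact_mod_cast F.D_pos.ne'

/-- The action `τ ↦ (Aτ + B) / D` of the upper triangular factor on `ℍ`. -/
noncomputable def act (τ : ℍ) : ℍ :=
  ⟨(F.A * τ + F.B) / F.D, by
    have hA : (0 : ℝ) < F.A := by exact_mod_cast F.A_pos
    have hD : (0 : ℝ) < F.D := by exact_mod_cast F.D_pos
    rw [Complex.div_natCast_im, show ((F.A : ℂ) * τ + F.B).im = F.A * τ.im by simp]
    have := τ.im_pos
    positivity⟩

lemma coe_act (τ : ℍ) : (F.act τ : ℂ) = (F.A * τ + F.B) / F.D := rfl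

lemma im_act (τ : ℍ) : (F.act τ).im = F.A / F.D * τ.im := by
  rw [← coe_im, coe_act, Complex.div_natCast_im,
    show ((F.A : ℂ) * τ + F.B).im = F.A * τ.im by simp]
  ring

lemma tendsto_act : Filter.Tendsto F.act atImInfty atImInfty := by
  have hA : (0 : ℝ) < F.A := by exact_mod_cast F.A_pos
  have hD : (0 : ℝ) < F.D := by exact_mod_cast F.D_pos
  refine Filter.tendsto_comap_iff.mpr ?_
  simp only [Function.comp_def, im_act]
  exact Filter.Tendsto.const_mul_atTop (by positivity) Filter.tendsto_comap

lemma denom_eq (τ : ℍ) : denom g τ = F.D * denom F.left (F.act τ) := by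
  obtain ⟨-, h10, h11⟩ := diag_mul_eq_mul_upper_iff.mp F.diag_mul
  have hD := F.D_ne_zero
  rw [ModularGroup.denom_apply, ModularGroup.denom_apply, coe_act, h10, h11]
  push_cast
  field_simp
  ring

lemma coe_left_smul_act (τ : ℍ) : ((F.left • F.act τ : ℍ) : ℂ) = m * (g • τ : ℍ) := by
  obtain ⟨⟨h00, h01⟩, -⟩ := diag_mul_eq_mul_upper_iff.mp F.diag_mul
  have h00c : (m : ℂ) * g 0 0 = F.left 0 0 * F.A := by exact_mod_cast h00
  have h01c : (m : ℂ) * g 0 1 = F.left 0 0 * F.B + F.left 0 1 * F.D := by exact_mod_cast h01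
  have hD := F.D_ne_zero
  have hnum : (m : ℂ) * (g 0 0 * τ + g 0 1) = F.D * (F.left 0 0 * F.act τ + F.left 0 1) := by
    rw [mul_add, ← mul_assoc, h00c, h01c, coe_act]
    field_simp
    ring
  have hcoe (γ : SL(2, ℤ)) (τ : ℍ) : ((γ • τ : ℍ) : ℂ) = (γ 0 0 * τ + γ 0 1) / denom γ τ := by
    rw [coe_specialLinearGroup_apply, ModularGroup.denom_apply]
    simp
  rw [hcoe, hcoe, F.denom_eq, ← mul_div_assoc, hnum, mul_div_mul_left _ _ hD]

lemma thetaDet_smul (hm : 0 < m) (τ : ℍ) (z : ℂ) :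
    thetaDet m (g • τ) (z / denom g τ) =
      cexp (2 * π * I * (m * ((g 1 0 : ℤ) * z ^ 2 / denom g τ))) * denom g τ *
        ((weilMatrix F.left).det / F.D) * thetaDet 1 (F.act τ) (F.A * z) := by
  obtain ⟨-, h10, -⟩ := diag_mul_eq_mul_upper_iff.mp F.diag_mul
  have hD := F.D_ne_zero
  have hden : denom (F.left : GL (Fin 2) ℝ) (F.act τ) ≠ 0 := denom_ne_zero _ _
  have harg : (m : ℂ) * (z / denom g τ) = F.A * z / denom F.left (F.act τ) := by
    rw [F.denom_eq, F.index_eq]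
    field_simp
  have hexp : (m : ℂ) * ((g 1 0 : ℤ) * z ^ 2 / denom g τ) =
      (F.left 1 0 : ℤ) * (F.A * z) ^ 2 / denom F.left (F.act τ) := by
    rw [F.denom_eq, F.index_eq, h10]
    push_cast
    field_simp
  rw [thetaDet_eq_index_one hm (F.coe_left_smul_act τ), harg,
    (weilMatrix_spec F.left).thetaDet_smul, hexp, F.denom_eq]
  field_simp

end CuspFactorization

lemma thetaDet_smul_of_mem_Gamma0 {m : ℕ} (hm : 0 < m) (γ : CongruenceSubgroup.Gamma0 m) (τ : ℍ)
    (z : ℂ) :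
    thetaDet m ((γ : SL(2, ℤ)) • τ) (z / denom (γ : SL(2, ℤ)) τ) =
      cexp (2 * π * I * (m * (((γ : SL(2, ℤ)) 1 0 : ℤ) * z ^ 2 / denom (γ : SL(2, ℤ)) τ))) *
        denom (γ : SL(2, ℤ)) τ * omega m γ * thetaDet m τ z := by
  let F := CuspFactorization.ofGamma0 hm γ
  have hact : (F.act τ : ℂ) = m * τ := by simp [F, CuspFactorization.coe_act,
    CuspFactorization.ofGamma0]
  have hfactor : (weilMatrix F.left).det / F.D = omega m γ := by
    simp [F, CuspFactorization.ofGamma0, omega]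
  rw [F.thetaDet_smul hm, hfactor, thetaDet_eq_index_one hm hact]
  rfl

lemma pow_twelve_eq_one {M : Type*} [CommMonoid M] (f : SL(2, ℤ) →* M) (γ : SL(2, ℤ)) :
    f γ ^ 12 = 1 := by
  have hS : f S ^ 4 = 1 := by rw [← map_pow, show S ^ 4 = 1 by decide, map_one]
  have hST : f S ^ 6 * f T ^ 6 = 1 := by
    rw [← mul_pow, ← map_mul, ← map_pow, show (S * T) ^ 6 = 1 by decide, map_one]
  have hS12 : f S ^ 12 = 1 := by rw [pow_mul (f S) 4 3, hS, one_pow]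
  have hT12 : f T ^ 12 = 1 := by
    calc f T ^ 12 = f S ^ 12 * f T ^ 12 := by rw [hS12, one_mul]
      _ = (f S ^ 6 * f T ^ 6) ^ 2 := by rw [mul_pow, ← pow_mul, ← pow_mul]
      _ = 1 := by rw [hST, one_pow]
  have hgen : (powMonoidHom 12).comp f = 1 :=
    MonoidHom.eq_of_eqOn_dense SpecialLinearGroup.SL2Z_generators fun x hx => by
      obtain rfl | rfl : x = S ∨ x = T := hx
      exacts [hS12, hT12]
  exact DFunLike.congr_fun hgen γ

lemma det_weilMatrix_pow_twelve (γ : SL(2, ℤ)) : (weilMatrix γ).det ^ 12 = 1 :=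
  pow_twelve_eq_one (MonoidHom.mk ⟨fun γ => (weilMatrix γ).det, det_weilMatrix_one⟩
    det_weilMatrix_mul) γ

lemma det_weilMatrix_ne_zero (γ : SL(2, ℤ)) : (weilMatrix γ).det ≠ 0 := fun h => by
  simpa [h] using det_weilMatrix_pow_twelve γ

lemma omega_pow_twelve (m : ℕ) (γ : CongruenceSubgroup.Gamma0 m) : omega m γ ^ 12 = 1 :=
  det_weilMatrix_pow_twelve _

lemma conj_omega_mul_self (m : ℕ) (γ : CongruenceSubgroup.Gamma0 m) :
    conj (omega m γ) * omega m γ = 1 := by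
  rw [Complex.conj_mul', Complex.norm_eq_one_of_pow_eq_one (omega_pow_twelve m γ) (by norm_num),
    Complex.ofReal_one, one_pow]

/-! ### Fourier expansions of Jacobi forms -/

lemma HasJacobiExpansion.of_hasSum {ι : Type*} {m M : ℕ} (hM : 0 < M) {φ : ℍ → ℂ → ℂ}
    (C : ι → ℂ) (N : ι → ℚ) (R : ι → ℤ) (hden : ∀ i, C i ≠ 0 → ∃ j : ℤ, N i = j / M)
    (hbound : ∀ i, C i ≠ 0 → (R i : ℚ) ^ 2 / (4 * m) ≤ N i)
    (hsum : ∀ (τ : ℍ) (z : ℂ), HasSum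
      (fun i => C i * cexp (2 * π * I * (N i * τ + R i * z))) (φ τ z)) :
    HasJacobiExpansion m φ := by
  let F : ι → ℚ × ℤ := fun i => (N i, R i)
  have hsupp (n : ℚ) (r : ℤ) (h : ∑' i : {i // F i = (n, r)}, C i ≠ 0) :
      ∃ i, C i ≠ 0 ∧ N i = n ∧ R i = r := by
    by_contra! hzero
    refine h ((tsum_congr fun ⟨i, hi⟩ => ?_).trans tsum_zero)
    by_contra hi'
    exact hzero i hi' (congrArg Prod.fst hi) (congrArg Prod.snd hi)
  refine ⟨fun n r => ∑' i : {i // F i = (n, r)}, C i, ⟨M, hM, fun n r h => ?_⟩, fun n r h => ?_,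
    fun τ z => ?_⟩
  · obtain ⟨i, hi, rfl, rfl⟩ := hsupp n r h
    exact hden i hi
  · obtain ⟨i, hi, rfl, rfl⟩ := hsupp n r h
    exact hbound i hi
  · have hfiber := (Equiv.sigmaFiberEquiv F).hasSum_iff.mpr (hsum τ z)
    refine hfiber.sigma fun p => ?_
    have hcoeff : (∑' i : {i // F i = (p.1, p.2)}, C i) * cexp (2 * π * I * (p.1 * τ + p.2 * z)) =
        ∑' i : {i // F i = p}, C i * cexp (2 * π * I * (N i * τ + R i * z)) := by
      rw [← tsum_mul_right]
      refine tsum_congr fun ⟨i, hi⟩ => ?_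
      have hN : N i = p.1 := congrArg Prod.fst hi
      have hR : R i = p.2 := congrArg Prod.snd hi
      simp only [hN, hR]
    exact hcoeff ▸ (hfiber.summable.sigma_factor p).hasSum

lemma hasSum_mul_prod {ι κ : Type*} {f : ι → ℂ} {g : κ → ℂ} {s t : ℂ} (hf : HasSum f s)
    (hg : HasSum g t) : HasSum (fun p : ι × κ => f p.1 * g p.2) (s * t) :=
  hf.mul hg (summable_mul_of_summable_norm hf.summable.norm hg.summable.norm)

lemma HasJacobiExpansion.mul_left {ι : Type*} {m H : ℕ} (hH : 0 < H) {C : ι → ℂ} {N : ι → ℕ}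
    {f : ℍ → ℂ} {φ : ℍ → ℂ → ℂ}
    (hf : ∀ τ : ℍ, HasSum (fun i => C i * cexp (2 * π * I * (N i / H * τ))) (f τ))
    (hφ : HasJacobiExpansion m φ) : HasJacobiExpansion m fun τ z => f τ * φ τ z := by
  obtain ⟨c, ⟨M, hM, hden⟩, hbound, hsum⟩ := hφ
  have hHq : (H : ℚ) ≠ 0 := by exact_mod_cast hH.ne'
  have hMq : (M : ℚ) ≠ 0 := by exact_mod_cast hM.ne'
  refine .of_hasSum (ι := ι × ℚ × ℤ) (M := H * M) (by positivity)
    (fun i => C i.1 * c i.2.1 i.2.2) (fun i => N i.1 / H + i.2.1) (fun i => i.2.2)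
    (fun i hi => ?_) (fun i hi => ?_) fun τ z => ?_
  · obtain ⟨j, hj⟩ := hden _ _ (right_ne_zero_of_mul hi)
    refine ⟨N i.1 * M + H * j, ?_⟩
    rw [hj]
    push_cast
    field_simp
  · exact (hbound _ _ (right_ne_zero_of_mul hi)).trans (le_add_of_nonneg_left (by positivity))
  · refine (hasSum_mul_prod (hf τ) (hsum τ z)).congr_fun fun i => ?_
    rw [mul_mul_mul_comm, ← Complex.exp_add]
    congr 2
    push_cast
    ring

namespace CuspFactorization

variable {m : ℕ} {g : SL(2, ℤ)} (F : CuspFactorization m g)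

lemma hasSum_thetaJ_one_act (r : ℕ) (τ : ℍ) (z : ℂ) :
    HasSum (fun n : ℤ => cexp (2 * π * I * ((2 * n + r) ^ 2 * F.B / (4 * F.D))) *
      cexp (2 * π * I * ((2 * n + r) ^ 2 * F.A / (4 * F.D) * τ + (2 * n + r) * F.A * z)))
      (thetaJ 1 r (F.act τ) (F.A * z)) := by
  have hD := F.D_ne_zero
  refine (hasSum_thetaJ_one r (F.act τ) (F.A * z)).congr_fun fun n => ?_
  rw [← Complex.exp_add, coe_act]
  congr 1
  field_simp
  ring

lemma hasJacobiExpansion_thetaJ_one_act (r : ℕ) :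
    HasJacobiExpansion m fun τ z => thetaJ 1 r (F.act τ) (F.A * z) := by
  have hA : (F.A : ℚ) ≠ 0 := by exact_mod_cast F.A_pos.ne'
  have hD : (F.D : ℚ) ≠ 0 := by exact_mod_cast F.D_pos.ne'
  have hindex : (m : ℚ) = F.A * F.D := by exact_mod_cast F.index_eq
  refine .of_hasSum (M := 4 * F.D) (Nat.mul_pos four_pos F.D_pos)
    (fun n : ℤ => cexp (2 * π * I * ((2 * n + r) ^ 2 * F.B / (4 * F.D))))
    (fun n => (2 * n + r) ^ 2 * F.A / (4 * F.D)) (fun n => (2 * n + r) * F.A)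
    (fun n _ => ⟨(2 * n + r) ^ 2 * F.A, by push_cast; rfl⟩) (fun n _ => le_of_eq ?_)
    fun τ z => ?_
  · rw [hindex]
    push_cast
    field_simp
  · simpa using F.hasSum_thetaJ_one_act r τ z

lemma hasSum_theta_one_act (r : ℕ) (τ : ℍ) :
    HasSum (fun n : ℤ => cexp (2 * π * I * ((2 * n + r) ^ 2 * F.B / (4 * F.D))) *
      cexp (2 * π * I * (((2 * n + r).natAbs ^ 2 * F.A : ℕ) / (4 * F.D : ℕ) * τ)))
      (theta 1 r (F.act τ)) := by
  have h := F.hasSum_thetaJ_one_act r τ 0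
  rw [mul_zero, ← theta] at h
  refine h.congr_fun fun n => ?_
  have hsq : ((2 * n + r).natAbs : ℂ) ^ 2 = (2 * n + r) ^ 2 := by
    rw [← Int.cast_natCast, ← Int.cast_pow, Int.natAbs_sq]
    push_cast
    rfl
  push_cast
  rw [hsq, mul_zero, add_zero]

lemma hasJacobiExpansion_thetaDet_act :
    HasJacobiExpansion m fun τ z => thetaDet 1 (F.act τ) (F.A * z) := by
  have hprod (r s : ℕ) : HasJacobiExpansion m fun τ z =>
      theta 1 r (F.act τ) * thetaJ 1 s (F.act τ) (F.A * z) :=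
    (F.hasJacobiExpansion_thetaJ_one_act s).mul_left (Nat.mul_pos four_pos F.D_pos)
      (F.hasSum_theta_one_act r)
  convert (hprod 1 0).add ((hprod 0 1).smul (-1)) using 1
  ext τ z
  simp [thetaDet, sub_eq_add_neg]

end CuspFactorization

/-! ### Modular forms with character at the cusps -/

lemma conj_T_zpow_apply (g : SL(2, ℤ)) (h : ℤ) :
    (g * T ^ h * g⁻¹) 1 0 = -(h * g 1 0 ^ 2) ∧ (g * T ^ h * g⁻¹) 1 1 = 1 + h * (g 0 0 * g 1 0) := by
  have hdet : g 0 0 * g 1 1 - g 0 1 * g 1 0 = 1 := by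
    rw [← Matrix.det_fin_two, g.det_coe]
  have hrow (j : Fin 2) : (g * T ^ h * g⁻¹) 1 j =
      g 1 0 * g⁻¹ 0 j + (g 1 0 * h + g 1 1) * g⁻¹ 1 j := by
    rw [Matrix.SpecialLinearGroup.coe_mul, Matrix.SpecialLinearGroup.coe_mul, coe_T_zpow]
    simp [Matrix.mul_apply, Fin.sum_univ_two]
  rw [hrow, hrow, Matrix.SpecialLinearGroup.coe_inv, Matrix.adjugate_fin_two]
  simp only [Matrix.of_apply, Matrix.cons_val', Matrix.cons_val_zero, Matrix.cons_val_one,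
    Matrix.cons_val_fin_one]
  exact ⟨by ring, by linear_combination hdet⟩

lemma conj_T_zpow_mem_Gamma0 (g : SL(2, ℤ)) {M : ℕ} {h : ℤ} (hh : (M : ℤ) ∣ h) :
    g * T ^ h * g⁻¹ ∈ CongruenceSubgroup.Gamma0 M := by
  rw [CongruenceSubgroup.Gamma0_mem, ZMod.intCast_zmod_eq_zero_iff_dvd, (conj_T_zpow_apply g h).1]
  exact (hh.mul_right _).neg_right

lemma chiOmegaBar_conj_T_zpow {m N : ℕ} (χ : DirichletCharacter ℂ (m * N)) (g : SL(2, ℤ))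
    (hmem : g * T ^ (12 * (m * N : ℕ) : ℤ) * g⁻¹ ∈ CongruenceSubgroup.Gamma0 (m * N)) :
    chiOmegaBar m N χ ⟨_, hmem⟩ = 1 := by
  have hpow : (⟨_, hmem⟩ : CongruenceSubgroup.Gamma0 (m * N)) =
      ⟨g * T ^ ((m * N : ℕ) : ℤ) * g⁻¹, conj_T_zpow_mem_Gamma0 g dvd_rfl⟩ ^ 12 := by
    apply Subtype.ext
    simp only [SubmonoidClass.mk_pow, conj_pow]
    rw [mul_comm 12, zpow_mul]
    rfl
  have hd : (((g * T ^ (12 * (m * N : ℕ) : ℤ) * g⁻¹) 1 1 : ℤ) : ZMod (m * N)) = 1 := by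
    rw [(conj_T_zpow_apply g _).2]
    push_cast
    rw [← Nat.cast_mul, ZMod.natCast_self, mul_zero, zero_mul, add_zero]
  rw [chiOmegaBar]
  simp only [hd, map_one, one_mul]
  rw [hpow, map_pow, map_pow, omega_pow_twelve, map_one]

lemma slash_T_zpow_apply (k : ℤ) (f : ℍ → ℂ) (h : ℤ) (τ : ℍ) :
    (f ∣[k] (T ^ h)) τ = f ((h : ℝ) +ᵥ τ) := by
  have hden : denom ((T ^ h : SL(2, ℤ)) : GL (Fin 2) ℝ) τ = 1 := by
    rw [ModularGroup.denom_apply, coe_T_zpow]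
    simp
  rw [ModularForm.SL_slash_apply, hden, one_zpow, mul_one, modular_T_zpow_smul]

lemma periodic_comp_ofComplex {f : ℍ → ℂ} {h : ℝ} (hf : ∀ τ : ℍ, f (h +ᵥ τ) = f τ) :
    Function.Periodic (f ∘ ofComplex) h := fun w => by
  rcases lt_or_ge 0 w.im with hw | hw
  · have hw' : 0 < (w + h).im := by simpa using hw
    rw [Function.comp_apply, Function.comp_apply, ofComplex_apply_of_im_pos hw',
      ofComplex_apply_of_im_pos hw, ← hf ⟨w, hw⟩]
    exact congrArg f (UpperHalfPlane.ext (add_comm _ _))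
  · have hw' : (w + h).im ≤ 0 := by simpa using hw
    rw [Function.comp_apply, Function.comp_apply, ofComplex_apply_of_im_nonpos hw',
      ofComplex_apply_of_im_nonpos hw]

lemma slash_periodic_of_mem_modularForms {k h : ℤ} {M : ℕ} {v : CongruenceSubgroup.Gamma0 M → ℂ}
    {f : ℍ → ℂ} (hf : f ∈ modularForms k M v) {g : SL(2, ℤ)}
    (hmem : g * T ^ h * g⁻¹ ∈ CongruenceSubgroup.Gamma0 M) (hv : v ⟨_, hmem⟩ = 1) :
    Function.Periodic ((f ∣[k] g) ∘ ofComplex) h := by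
  have hconj : f ∣[k] (g * T ^ h * g⁻¹) = f := by simpa [hv] using hf.2.1 ⟨_, hmem⟩
  have hinv : (f ∣[k] g) ∣[k] (T ^ h) = f ∣[k] g := by
    rw [← SlashAction.slash_mul]
    nth_rw 2 [← hconj]
    rw [← SlashAction.slash_mul, inv_mul_cancel_right]
  rw [← ofReal_intCast]
  exact periodic_comp_ofComplex fun τ => by rw [← slash_T_zpow_apply k (f ∣[k] g) h, hinv]

lemma exists_hasSum_slash {k : ℤ} {m N : ℕ} (hmN : 0 < m * N) {χ : DirichletCharacter ℂ (m * N)}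
    {f : ℍ → ℂ} (hf : f ∈ modularForms k (m * N) (chiOmegaBar m N χ)) (g : SL(2, ℤ)) :
    ∃ a : ℕ → ℂ, ∀ τ : ℍ, HasSum
      (fun j : ℕ => a j * cexp (2 * π * I * (j / (12 * (m * N) : ℕ) * τ))) ((f ∣[k] g) τ) := by
  have hH : (0 : ℝ) < (12 * (m * N) : ℕ) := by exact_mod_cast Nat.mul_pos (by norm_num) hmN
  have hperiodic : Function.Periodic ((f ∣[k] g) ∘ ofComplex) ((12 * (m * N) : ℕ) : ℝ) := by
    simpa using slash_periodic_of_mem_modularForms hf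
      (conj_T_zpow_mem_Gamma0 g (dvd_mul_left _ 12)) (chiOmegaBar_conj_T_zpow χ g _)
  refine ⟨fun j => (qExpansion ((12 * (m * N) : ℕ) : ℝ) (f ∣[k] g)).coeff j, fun τ => ?_⟩
  refine (hasSum_qExpansion hH hperiodic (hf.1.slash k g) (hf.2.2 g) τ).congr_fun fun j => ?_
  rw [smul_eq_mul, Function.Periodic.qParam, ← Complex.exp_nat_mul]
  congr 2
  push_cast
  ring

/-! ### Multiplication by the theta determinant -/

/-- The map `f ↦ f · thetaDet m`, which becomes the inverse of `Λ_m^*` on modular forms. -/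
noncomputable def mulThetaDet (m : ℕ) : (ℍ → ℂ) →ₗ[ℂ] (ℍ → ℂ → ℂ) where
  toFun f τ z := f τ * thetaDet m τ z
  map_add' f g := by ext τ z; simp [add_mul]
  map_smul' a f := by ext τ z; simp [mul_assoc]

lemma mulThetaDet_apply (m : ℕ) (f : ℍ → ℂ) (τ : ℍ) (z : ℂ) :
    mulThetaDet m f τ z = f τ * thetaDet m τ z := rfl

lemma jacobiSlash_mulThetaDet_of_smul {k : ℤ} {m : ℕ} {g : SL(2, ℤ)} {τ : ℍ} {z E : ℂ}
    (h : thetaDet m (g • τ) (z / denom g τ) =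
      cexp (2 * π * I * (m * ((g 1 0 : ℤ) * z ^ 2 / denom g τ))) * denom g τ * E) (f : ℍ → ℂ) :
    jacobiSlash k m (mulThetaDet m f) g τ z = (f ∣[k - 1] g) τ * E := by
  have hden : denom (g : GL (Fin 2) ℝ) τ ≠ 0 := denom_ne_zero _ _
  have := Complex.exp_ne_zero (2 * π * I * (m * ((g 1 0 : ℤ) * z ^ 2 / denom g τ)))
  rw [jacobiSlash, mulThetaDet_apply, h, ModularForm.SL_slash_apply, Complex.exp_neg,
    show -(k - 1) = -k + 1 by ring, zpow_add_one₀ hden]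
  field_simp

lemma CuspFactorization.jacobiSlash_mulThetaDet {m : ℕ} {g : SL(2, ℤ)} (F : CuspFactorization m g)
    (hm : 0 < m) (k : ℤ) (f : ℍ → ℂ) (τ : ℍ) (z : ℂ) :
    jacobiSlash k m (mulThetaDet m f) g τ z =
      (f ∣[k - 1] g) τ * ((weilMatrix F.left).det / F.D * thetaDet 1 (F.act τ) (F.A * z)) :=
  jacobiSlash_mulThetaDet_of_smul (by rw [F.thetaDet_smul hm, mul_assoc (_ * _)]) f

section PositiveIndex

variable {m : ℕ} (hm : 0 < m)
include hm

lemma mulThetaDet_injective : Function.Injective (mulThetaDet m) := fun f g h => by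
  funext τ
  exact mul_right_cancel₀ (thetaDet_inv_two_mul_ne_zero hm τ)
    (congrFun (congrFun h τ) (1 / (2 * m)))

lemma isHolomorphic_mulThetaDet_iff {f : ℍ → ℂ} :
    IsHolomorphic (mulThetaDet m f) ↔ MDifferentiable 𝓘(ℂ) 𝓘(ℂ) f := by
  rw [mdifferentiable_iff]
  refine ⟨fun h => ?_, fun h => ?_⟩
  · have hslice {ψ : ℍ → ℂ → ℂ} (hψ : IsHolomorphic ψ) :
        DifferentiableOn ℂ (fun w => ψ (ofComplex w) (1 / (2 * m))) {z | 0 < z.im} :=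
      DifferentiableOn.comp (t := {p : ℂ × ℂ | 0 < p.1.im}) hψ
        (f := fun w : ℂ => (w, (1 / (2 * m) : ℂ))) (by fun_prop) fun p hp => hp
    refine ((hslice h).div (hslice (isHolomorphic_thetaDet hm)) fun w _ =>
      thetaDet_inv_two_mul_ne_zero hm _).congr fun w _ => ?_
    rw [Function.comp_apply, Pi.div_apply, mulThetaDet_apply,
      mul_div_cancel_right₀ _ (thetaDet_inv_two_mul_ne_zero hm _)]
  · have hfst : DifferentiableOn ℂ (fun p : ℂ × ℂ => f (ofComplex p.1)) {p | 0 < p.1.im} :=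
      h.comp (f := fun p : ℂ × ℂ => p.1) (by fun_prop) fun p hp => hp
    exact DifferentiableOn.mul hfst (isHolomorphic_thetaDet hm)

lemma jacobiSlash_mulThetaDet_eq_smul_iff {k : ℤ} {N : ℕ} {χ : DirichletCharacter ℂ (m * N)}
    {f : ℍ → ℂ} (γ : CongruenceSubgroup.Gamma0 (m * N)) :
    jacobiSlash k m (mulThetaDet m f) γ =
        χ (((γ : SL(2, ℤ)) 1 1 : ℤ) : ZMod (m * N)) • mulThetaDet m f ↔
      f ∣[k - 1] (γ : SL(2, ℤ)) = chiOmegaBar m N χ γ • f := by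
  let γ' := Subgroup.inclusion (Gamma0_mul_le m N) γ
  have hslash (τ : ℍ) (z : ℂ) : jacobiSlash k m (mulThetaDet m f) γ τ z =
      (f ∣[k - 1] (γ : SL(2, ℤ))) τ * (omega m γ' * thetaDet m τ z) :=
    jacobiSlash_mulThetaDet_of_smul
      ((thetaDet_smul_of_mem_Gamma0 hm γ' τ z).trans (mul_assoc (_ * _) _ _)) f
  have hconj : conj (omega m γ') * omega m γ' = 1 := conj_omega_mul_self m γ'
  refine ⟨fun h => funext fun τ => ?_, fun h => funext₂ fun τ z => ?_⟩
  · have hz := congrFun (congrFun h τ) (1 / (2 * m))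
    simp only [hslash, Pi.smul_apply, smul_eq_mul, mulThetaDet_apply] at hz
    refine mul_right_cancel₀ (thetaDet_inv_two_mul_ne_zero hm τ) ?_
    simp only [Pi.smul_apply, smul_eq_mul, chiOmegaBar]
    linear_combination conj (omega m γ') * hz -
      (f ∣[k - 1] (γ : SL(2, ℤ))) τ * thetaDet m τ (1 / (2 * m)) * hconj
  · rw [hslash, h]
    simp only [Pi.smul_apply, smul_eq_mul, chiOmegaBar, mulThetaDet_apply]
    linear_combination
      (χ (((γ : SL(2, ℤ)) 1 1 : ℤ) : ZMod (m * N)) * f τ * thetaDet m τ z) * hconj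

end PositiveIndex

/-! ### From modular forms to Jacobi forms -/

section PositiveIndex

variable {m : ℕ} (hm : 0 < m)
include hm

lemma isThetaDecomposition_mulThetaDet (f : ℍ → ℂ) :
    IsThetaDecomposition m (mulThetaDet m f) fun r τ =>
      if r = 0 then f τ * theta m m τ else if r = m then -(f τ * theta m 0 τ) else 0 := by
  refine ⟨fun r hr => funext fun τ => ?_, fun τ z => ?_⟩
  · simp only [if_neg (show r ≠ 0 by omega), if_neg (show r ≠ m by omega), Pi.zero_apply]
  · rw [sum_range_two_mul_eq hm fun r hr hr' => by simp only [if_neg hr, if_neg hr', zero_mul]]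
    simp only [if_true, if_neg hm.ne', mulThetaDet_apply, thetaDet]
    ring

lemma hasJacobiExpansion_jacobiSlash_mulThetaDet {k : ℤ} {N : ℕ} (hN : 0 < N)
    {χ : DirichletCharacter ℂ (m * N)} {f : ℍ → ℂ}
    (hf : f ∈ modularForms (k - 1) (m * N) (chiOmegaBar m N χ)) (g : SL(2, ℤ)) :
    HasJacobiExpansion m (jacobiSlash k m (mulThetaDet m f) g) := by
  obtain ⟨F⟩ := CuspFactorization.nonempty hm g
  have hmN : 0 < m * N := Nat.mul_pos hm hN
  obtain ⟨a, ha⟩ := exists_hasSum_slash hmN hf g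
  convert (F.hasJacobiExpansion_thetaDet_act.mul_left (Nat.mul_pos (by norm_num) hmN) ha).smul
    ((weilMatrix F.left).det / F.D) using 1
  ext τ z
  rw [F.jacobiSlash_mulThetaDet hm, Pi.smul_apply, Pi.smul_apply, smul_eq_mul, mul_left_comm]

lemma mulThetaDet_mem_jacobiForms {k : ℤ} {N : ℕ} (hN : 0 < N)
    {χ : DirichletCharacter ℂ (m * N)} {f : ℍ → ℂ}
    (hf : f ∈ modularForms (k - 1) (m * N) (chiOmegaBar m N χ)) :
    mulThetaDet m f ∈ jacobiForms k m (m * N) χ := by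
  refine ⟨(isHolomorphic_mulThetaDet_iff hm).mpr hf.1,
    fun γ hγ => (jacobiSlash_mulThetaDet_eq_smul_iff hm ⟨γ, hγ⟩).mpr (hf.2.1 _),
    fun l μ τ z => ?_, hasJacobiExpansion_jacobiSlash_mulThetaDet hm hN hf⟩
  rw [mulThetaDet_apply, mulThetaDet_apply, thetaDet_elliptic hm, mul_left_comm]

lemma mulThetaDet_mem_jacobiFormsStarKer {k : ℤ} {N : ℕ} (hN : 0 < N)
    {χ : DirichletCharacter ℂ (m * N)} {f : ℍ → ℂ}
    (hf : f ∈ modularForms (k - 1) (m * N) (chiOmegaBar m N χ)) :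
    mulThetaDet m f ∈ jacobiFormsStarKer k m (m * N) χ := by
  refine ⟨⟨mulThetaDet_mem_jacobiForms hm hN hf, _, isThetaDecomposition_mulThetaDet hm f,
    fun r hr hr' => funext fun τ => ?_⟩, LinearMap.mem_ker.mpr (funext fun τ => ?_)⟩
  · rw [if_neg hr, if_neg hr', Pi.zero_apply]
  · change mulThetaDet m f τ 0 = 0
    rw [mulThetaDet_apply, thetaDet_zero, mul_zero]

end PositiveIndex

/-! ### From Jacobi forms to modular forms -/

lemma norm_exp_two_pi_I_mul (w : ℂ) : ‖cexp (2 * π * I * w)‖ = Real.exp (-(2 * π * w.im)) := by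
  rw [Complex.norm_exp]
  congr 1
  simp

lemma isBoundedAtImInfty_of_hasSum {ι : Type*} {c : ι → ℂ} {N : ι → ℝ}
    (hN : ∀ i, c i ≠ 0 → 0 ≤ N i) {f : ℍ → ℂ}
    (hf : ∀ τ : ℍ, HasSum (fun i => c i * cexp (2 * π * I * (N i * τ))) (f τ)) :
    IsBoundedAtImInfty f := by
  have hnorm (i : ι) (τ : ℍ) : ‖c i * cexp (2 * π * I * (N i * τ))‖ =
      ‖c i‖ * Real.exp (-(2 * π * (N i * τ.im))) := by
    rw [norm_mul, norm_exp_two_pi_I_mul, Complex.im_ofReal_mul, coe_im]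
  refine isBoundedAtImInfty_iff.mpr
    ⟨∑' i, ‖c i * cexp (2 * π * I * (N i * (UpperHalfPlane.I : ℍ)))‖, 1, fun τ hτ => ?_⟩
  rw [← (hf τ).tsum_eq]
  refine tsum_of_norm_bounded (hf UpperHalfPlane.I).summable.norm.hasSum fun i => ?_
  rcases eq_or_ne (c i) 0 with hc | hc
  · simp [hc]
  · have := hN i hc
    rw [hnorm, hnorm, UpperHalfPlane.I_im]
    gcongr

-- Completing the square, `n + rl + ml² ≥ (r + 2ml)² / 4m ≥ 0` whenever `c(n,r) ≠ 0`.
lemma HasJacobiExpansion.isBoundedAtImInfty {m : ℕ} (hm : 0 < m) {φ : ℍ → ℂ → ℂ}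
    (h : HasJacobiExpansion m φ) (l u : ℝ) :
    IsBoundedAtImInfty fun τ => cexp (2 * π * I * (m * l ^ 2 * τ)) * φ τ (l * τ + u) := by
  obtain ⟨c, -, hc, hs⟩ := h
  refine isBoundedAtImInfty_of_hasSum
    (c := fun p : ℚ × ℤ => c p.1 p.2 * cexp (2 * π * I * (p.2 * u)))
    (N := fun p => p.1 + p.2 * l + m * l ^ 2) (fun p hp => ?_) fun τ => ?_
  · have hn : (p.2 : ℝ) ^ 2 / (4 * m) ≤ p.1 := by
      exact_mod_cast hc _ _ (left_ne_zero_of_mul hp)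
    have : (0 : ℝ) < m := by exact_mod_cast hm
    calc (0 : ℝ) ≤ (p.2 + 2 * m * l) ^ 2 / (4 * m) := by positivity
      _ = (p.2 : ℝ) ^ 2 / (4 * m) + p.2 * l + m * l ^ 2 := by field_simp; ring
      _ ≤ p.1 + p.2 * l + m * l ^ 2 := by gcongr
  · refine ((hs τ (l * τ + u)).mul_left (cexp (2 * π * I * (m * l ^ 2 * τ)))).congr_fun fun p => ?_
    rw [mul_left_comm (cexp _), ← Complex.exp_add, mul_assoc (c _ _), ← Complex.exp_add]
    push_cast
    ring_nf

lemma tendsto_jacobiTheta : Filter.Tendsto jacobiTheta (Filter.comap Complex.im Filter.atTop)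
    (nhds 1) := by
  have hexp : Filter.Tendsto (fun τ : ℂ => Real.exp (-π * τ.im))
      (Filter.comap Complex.im Filter.atTop) (nhds 0) :=
    Real.tendsto_exp_atBot.comp
      (Filter.tendsto_comap.const_mul_atTop_of_neg (neg_neg_of_pos Real.pi_pos))
  simpa using (isBigO_at_im_infty_jacobiTheta_sub_one.trans_tendsto hexp).add_const 1

lemma tendsto_jacobiTheta_ofReal_mul {a : ℝ} (ha : 0 < a) :
    Filter.Tendsto (fun τ : ℍ => jacobiTheta (a * τ)) atImInfty (nhds 1) := by
  refine tendsto_jacobiTheta.comp (Filter.tendsto_comap_iff.mpr ?_)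
  have him : Filter.Tendsto UpperHalfPlane.im atImInfty Filter.atTop := Filter.tendsto_comap
  simpa only [Function.comp_def, Complex.im_ofReal_mul, coe_im] using him.const_mul_atTop ha

lemma theta_one_zero_eq_jacobiTheta (τ : ℍ) : theta 1 0 τ = jacobiTheta (2 * τ) := by
  rw [theta, thetaJ_one_eq, jacobiTheta_eq_jacobiTheta₂]
  simp

lemma tendsto_theta_one_zero : Filter.Tendsto (theta 1 0) atImInfty (nhds 1) := by
  simpa only [Complex.ofReal_ofNat, ← theta_one_zero_eq_jacobiTheta] using
    tendsto_jacobiTheta_ofReal_mul zero_lt_two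

lemma tendsto_theta_one_one : Filter.Tendsto (theta 1 1) atImInfty (nhds 0) := by
  have hsub (τ : ℍ) : theta 1 1 τ = jacobiTheta ((1 / 2 : ℝ) * τ) - theta 1 0 τ := by
    rw [jacobiTheta_eq_jacobiTheta₂, show ((1 / 2 : ℝ) : ℂ) * τ = τ / 2 by push_cast; ring,
      thetaJ_split, theta, theta, add_sub_cancel_left]
  simpa only [← hsub, sub_self] using
    (tendsto_jacobiTheta_ofReal_mul one_half_pos).sub tendsto_theta_one_zero

lemma thetaJ_one_zero_half (τ : ℍ) :
    thetaJ 1 0 τ (τ / 2) = cexp (2 * π * I * (-τ / 4)) * theta 1 1 τ := by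
  rw [theta, thetaJ_one_eq, thetaJ_one_eq, ← mul_assoc, ← Complex.exp_add]
  congr 1 <;> push_cast <;> ring_nf

lemma thetaJ_one_one_half (τ : ℍ) :
    thetaJ 1 1 τ (τ / 2) = cexp (2 * π * I * (-τ / 4)) * theta 1 0 τ := by
  rw [theta_one_zero_eq_jacobiTheta, jacobiTheta_eq_jacobiTheta₂, thetaJ_one_eq,
    show ((1 : ℕ) : ℂ) * τ + 2 * (τ / 2) = 0 + 2 * τ by push_cast; ring, jacobiTheta₂_add_left',
    ← mul_assoc, ← Complex.exp_add]
  push_cast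
  ring_nf

lemma thetaDet_one_half (τ : ℍ) : thetaDet 1 τ (τ / 2) =
    cexp (2 * π * I * (-τ / 4)) * (theta 1 1 τ ^ 2 - theta 1 0 τ ^ 2) := by
  rw [thetaDet, thetaJ_one_zero_half, thetaJ_one_one_half]
  ring

lemma isBoundedAtImInfty_of_mul_of_tendsto {f G : ℍ → ℂ} {a : ℂ} (ha : a ≠ 0)
    (hG : Filter.Tendsto G atImInfty (nhds a)) (h : IsBoundedAtImInfty fun τ => f τ * G τ) :
    IsBoundedAtImInfty f := by
  refine Asymptotics.IsBigO.congr' (h.mul ((hG.inv₀ ha).isBigO_one ℝ)) ?_ ?_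
  · filter_upwards [hG.eventually_ne ha] with τ hτ
    exact mul_inv_cancel_right₀ hτ _
  · exact Filter.Eventually.of_forall fun _ => by simp

-- Specialising `(f · thetaDet m)|g` to `z = σ / 2A`, where `σ = (Aτ + B) / D`, leaves `f|g` times a
-- function with a nonzero limit at `i∞`.
lemma isBoundedAtImInfty_slash_of_hasJacobiExpansion {k : ℤ} {m : ℕ} (hm : 0 < m) {f : ℍ → ℂ}
    {g : SL(2, ℤ)} (h : HasJacobiExpansion m (jacobiSlash k m (mulThetaDet m f) g)) :
    IsBoundedAtImInfty (f ∣[k - 1] g) := by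
  obtain ⟨F⟩ := CuspFactorization.nonempty hm g
  have hA := F.A_ne_zero
  have hD := F.D_ne_zero
  set κ : ℂ := (weilMatrix F.left).det / F.D * cexp (2 * π * I * (-F.B / (4 * F.D)))
  have hκ : κ ≠ 0 :=
    mul_ne_zero (div_ne_zero (det_weilMatrix_ne_zero F.left) hD) (Complex.exp_ne_zero _)
  have hlim : Filter.Tendsto
      (fun τ => κ * (theta 1 1 (F.act τ) ^ 2 - theta 1 0 (F.act τ) ^ 2)) atImInfty
      (nhds (κ * (0 ^ 2 - 1 ^ 2))) :=
    (((tendsto_theta_one_one.comp F.tendsto_act).pow 2).sub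
      ((tendsto_theta_one_zero.comp F.tendsto_act).pow 2)).const_mul κ
  refine isBoundedAtImInfty_of_mul_of_tendsto (by simpa using hκ) hlim ?_
  convert h.isBoundedAtImInfty hm (1 / (2 * F.D)) (F.B / (2 * (F.A * F.D))) using 2 with τ
  have hz : F.A * (((1 / (2 * F.D) : ℝ) : ℂ) * τ + ((F.B / (2 * (F.A * F.D)) : ℝ) : ℂ)) =
      F.act τ / 2 := by
    rw [F.coe_act]
    push_cast
    field_simp
  have hexp : cexp (2 * π * I * (-F.B / (4 * F.D))) =
      cexp (2 * π * I * (m * ((1 / (2 * F.D) : ℝ) : ℂ) ^ 2 * τ)) *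
        cexp (2 * π * I * (-F.act τ / 4)) := by
    rw [← Complex.exp_add, F.coe_act, F.index_eq]
    congr 1
    push_cast
    field_simp
    ring
  rw [F.jacobiSlash_mulThetaDet hm, hz, thetaDet_one_half]
  simp only [κ, hexp]
  ring

lemma mem_modularForms_of_mulThetaDet_mem {k : ℤ} {m N : ℕ} (hm : 0 < m)
    {χ : DirichletCharacter ℂ (m * N)} {f : ℍ → ℂ}
    (hf : mulThetaDet m f ∈ jacobiForms k m (m * N) χ) :
    f ∈ modularForms (k - 1) (m * N) (chiOmegaBar m N χ) := by
  obtain ⟨hol, hmod, -, hexp⟩ := hf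
  exact ⟨(isHolomorphic_mulThetaDet_iff hm).mp hol,
    fun γ => (jacobiSlash_mulThetaDet_eq_smul_iff hm γ).mp (hmod γ γ.2),
    fun g => isBoundedAtImInfty_slash_of_hasJacobiExpansion hm (hexp g)⟩

/-! ### The isomorphism -/

lemma exists_eq_mulThetaDet {m : ℕ} (hm : 0 < m) {k : ℤ} {M : ℕ} {χ : DirichletCharacter ℂ M}
    {φ : ℍ → ℂ → ℂ} (hφ : φ ∈ jacobiFormsStarKer k m M χ) : ∃ f, mulThetaDet m f = φ := by
  obtain ⟨⟨-, h, hdec, hvan⟩, hker⟩ := hφ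
  have hsum (τ : ℍ) (z : ℂ) : φ τ z = h 0 τ * thetaJ m 0 τ z + h m τ * thetaJ m m τ z := by
    rw [hdec.2, sum_range_two_mul_eq hm fun r hr hr' => by
      rw [hvan r hr hr', Pi.zero_apply, zero_mul]]
  refine ⟨fun τ => h 0 τ / theta m m τ, funext₂ fun τ z => ?_⟩
  have h0 : φ τ 0 = 0 := congrFun (LinearMap.mem_ker.mp hker) τ
  rw [hsum, ← theta, ← theta] at h0
  have hθ := theta_self_ne_zero hm τ
  rw [mulThetaDet_apply, hsum, thetaDet]
  field_simp
  linear_combination -thetaJ m m τ z * h0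

/-- Multiplication by `thetaDet m` as an isomorphism onto `J*_{k,m}(Γ₀(mN), χ)⁰`; it is the inverse
of `Λ_m^*`. -/
noncomputable def mulThetaDetEquiv (k : ℤ) {m N : ℕ} (hm : 0 < m) (hN : 0 < N)
    (χ : DirichletCharacter ℂ (m * N)) :
    modularForms (k - 1) (m * N) (chiOmegaBar m N χ) ≃ₗ[ℂ] jacobiFormsStarKer k m (m * N) χ :=
  LinearEquiv.ofBijective
    ((mulThetaDet m).restrict fun _ hf => mulThetaDet_mem_jacobiFormsStarKer hm hN hf)
    ⟨fun _ _ h => Subtype.ext (mulThetaDet_injective hm (congrArg Subtype.val h)), fun ⟨_, hφ⟩ => by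
      obtain ⟨f, rfl⟩ := exists_eq_mulThetaDet hm hφ
      exact ⟨⟨f, mem_modularForms_of_mulThetaDet_mem hm hφ.1.1⟩, rfl⟩⟩

lemma IsThetaDecomposition.eq_div_theta {m : ℕ} (hm : 0 < m) {f : ℍ → ℂ} {h : ℕ → ℍ → ℂ}
    (hh : IsThetaDecomposition m (mulThetaDet m f) h) (τ : ℍ) :
    f τ = h 0 τ / theta m m τ ∧ f τ = -h m τ / theta m 0 τ := by
  rw [hh.unique hm (isThetaDecomposition_mulThetaDet hm f)]
  simp only [if_true, if_neg hm.ne', neg_neg]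
  exact ⟨(mul_div_cancel_right₀ _ (theta_self_ne_zero hm τ)).symm,
    (mul_div_cancel_right₀ _ (theta_zero_ne_zero hm τ)).symm⟩

end JacobiTheta

open JacobiTheta in
theorem theorem4p1_general (k : ℤ) (m N : ℕ) (hm : 0 < m) (hN : 0 < N)
    (χ : DirichletCharacter ℂ (m * N)) :
    (∀ τ : ℍ, theta m 0 τ ≠ 0 ∧ theta m m τ ≠ 0) ∧
    (∀ φ ∈ jacobiForms k m (m * N) χ, ∃! h : ℕ → ℍ → ℂ, IsThetaDecomposition m φ h) ∧
    ∃ Λ : jacobiFormsStarKer k m (m * N) χ ≃ₗ[ℂ]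
        modularForms (k - 1) (m * N) (chiOmegaBar m N χ),
      (∀ (φ : jacobiFormsStarKer k m (m * N) χ) (h : ℕ → ℍ → ℂ),
        IsThetaDecomposition m φ h → ∀ τ : ℍ,
          (Λ φ : ℍ → ℂ) τ = h 0 τ / theta m m τ ∧
          (Λ φ : ℍ → ℂ) τ = -h m τ / theta m 0 τ) ∧
      ∀ (f : modularForms (k - 1) (m * N) (chiOmegaBar m N χ)) (τ : ℍ) (z : ℂ),
        (Λ.symm f : ℍ → ℂ → ℂ) τ z =
          (f : ℍ → ℂ) τ * (theta m m τ * thetaJ m 0 τ z - theta m 0 τ * thetaJ m m τ z) := by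
  refine ⟨fun τ => ⟨theta_zero_ne_zero hm τ, theta_self_ne_zero hm τ⟩, fun φ hφ => ?_,
    (mulThetaDetEquiv k hm hN χ).symm, fun φ h hh => ?_, fun f τ z => rfl⟩
  · exact existsUnique_of_exists_of_unique
      (exists_isThetaDecomposition hm (IsHolomorphic.differentiable hφ.1) hφ.2.2.1)
      fun _ _ hh hh' => hh.unique hm hh'
  · obtain ⟨f, rfl⟩ := (mulThetaDetEquiv k hm hN χ).surjective φ
    rw [LinearEquiv.symm_apply_apply]
    exact hh.eq_div_theta hm

theorem theorem4p1 (k m N : ℕ) (hk : 0 < k) (hm : Squarefree m) (hN : 0 < N)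
    (χ : DirichletCharacter ℂ (m * N)) :
    (∀ τ : ℍ, JacobiTheta.theta m 0 τ ≠ 0 ∧ JacobiTheta.theta m m τ ≠ 0) ∧
    (∀ φ ∈ JacobiTheta.jacobiForms k m (m * N) χ,
      ∃! h : ℕ → ℍ → ℂ, JacobiTheta.IsThetaDecomposition m φ h) ∧
    ∃ Λ : JacobiTheta.jacobiFormsStarKer k m (m * N) χ ≃ₗ[ℂ]
        JacobiTheta.modularForms ((k : ℤ) - 1) (m * N) (JacobiTheta.chiOmegaBar m N χ),
      (∀ (φ : JacobiTheta.jacobiFormsStarKer k m (m * N) χ) (h : ℕ → ℍ → ℂ),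
        JacobiTheta.IsThetaDecomposition m φ h → ∀ τ : ℍ,
          (Λ φ : ℍ → ℂ) τ = h 0 τ / JacobiTheta.theta m m τ ∧
          (Λ φ : ℍ → ℂ) τ = -h m τ / JacobiTheta.theta m 0 τ) ∧
      ∀ (f : JacobiTheta.modularForms ((k : ℤ) - 1) (m * N) (JacobiTheta.chiOmegaBar m N χ))
        (τ : ℍ) (z : ℂ),
        (Λ.symm f : ℍ → ℂ → ℂ) τ z =
          (f : ℍ → ℂ) τ * (JacobiTheta.theta m m τ * JacobiTheta.thetaJ m 0 τ z -
            JacobiTheta.theta m 0 τ * JacobiTheta.thetaJ m m τ z) :=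
  theorem4p1_general k m N (Nat.pos_of_ne_zero hm.ne_zero) hN χ
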